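/- Let $R$ be either (a) a commutative noetherian local ring with maximal ideal $m_R$, or (b) a connected graded noetherian algebra over a field $\mathbb{F}$ (that is, $R=\bigoplus_{d\ge 0}R^d$ with $R^0=\mathbb{F}$) which is commutative or graded-commutative ($xy=(-1)^{|x||y|}yx$ for homogeneous $x,y$), with $m_R=R^+$ the ideal of elements of positive degree. Let $R\text{-fgmod}$ be the category of finitely generated $R$-modules and $R$-linear maps in case (a), and of finitely generated non-negatively graded (left) $R$-modules and degree-preserving $R$-linear maps in case (b). For $N$ in $R\text{-fgmod}$, a sequence $x_1,\dots,x_r\in m_R$ (of homogeneous elements in case (b)) is called regular on $N$ if, for every $i$, $x_i$ is not a zero divisor on $N/(x_1,\dots,x_{i-1})N$, i.e. multiplication by $x_i$ is injective there. The depth of $N$ is the supremum in $\mathbb{N}\cup\{\infty\}$ of the lengths of such sequences; in particular $\operatorname{depth} 0=\infty$. Let $\mathcal{C}$ be a category, $\Phi:\mathcal{C}\to R\text{-fgmod}$ a covariant functor, $M$ an object of $R\text{-fgmod}$, and $1_M\to\Phi$ a natural transformation from the constant functor with value $M$. Let $\rho:M\to\lim_{\mathcal{C}}\Phi$ be the induced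 map. Put $L^{-1}=\ker\rho$, $L^0=\operatorname{coker}\rho$ and, for $i\ge 1$, $L^i=\lim^i_{\mathcal{C}}\Phi$, the $i$-th cohomology of the cochain complex $$C^n=\prod_{c_0\to c_1\to\cdots\to c_n}\Phi(c_n),\qquad \delta=\sum_{k=0}^{n+1}(-1)^k\delta^k:C^n\to C^{n+1},$$ where $(\delta^k u)(c_0\to\cdots\to c_{n+1})=u(c_0\to\cdots\widehat{c_k}\cdots\to c_{n+1})$ for $k\ne n+1$ and $(\delta^{n+1}u)(c_0\to\cdots\to c_{n+1})=\Phi(c_n\to c_{n+1})\,u(c_0\to\cdots\to c_n)$. In case (b) limits and products are those of graded modules, i.e. they are formed in each degree separately. If $L^i=0$ for all $i\ge -1$, then $$\operatorname{depth} M\ \ge\ \min\{\operatorname{depth}\Phi(c): c\in\mathcal{C}\},$$ where the minimum over the empty set is $\infty$. -/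

import Mathlib

open CategoryTheory CategoryTheory.Limits

universe u u' v w w'

namespace HigherLimits

/-! ### The cochain complex of a functor and the modules `L^i` -/

section Complex

variable {S : Type u} [Ring S] {C : Type w} [Category.{v} C] (Φ : C ⥤ ModuleCat.{w'} S)

/-- The module `C^n(𝒞, Φ)` of `n`-cochains: the product of the modules `Φ(c_n)` over all
sequences `c_0 ⟶ c_1 ⟶ ⋯ ⟶ c_n` of `n` composable morphisms, i.e. functors `[n] ⥤ 𝒞`. -/
abbrev Cochain (n : ℕ) : Type _ :=
  ∀ σ : ComposableArrows C n, Φ.obj (σ.obj (Fin.last n))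

/-- The sequence obtained from `c_0 ⟶ ⋯ ⟶ c_{n+1}` by omitting `c_k` (composing the two adjacent
morphisms if `c_k` is an inner object). -/
abbrev face {n : ℕ} (k : Fin (n + 2)) (σ : ComposableArrows C (n + 1)) : ComposableArrows C n :=
  (Fin.succAboveOrderEmb k).monotone.functor ⋙ σ

/-- The canonical morphism from the last object of the `k`-th face to the last object `c_{n+1}`.
For `k ≠ n + 1` these two objects coincide and the morphism is the identity;
for `k = n + 1` it is the last morphism `c_n ⟶ c_{n+1}` of the sequence. -/
abbrev faceToLast {n : ℕ} (k : Fin (n + 2)) (σ : ComposableArrows C (n + 1)) :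
    (face k σ).obj (Fin.last n) ⟶ σ.obj (Fin.last (n + 1)) :=
  σ.map (homOfLE (Fin.le_last (k.succAbove (Fin.last n))))

/-- The maps `δ^k : C^n ⟶ C^{n+1}`. For `k ≠ n + 1` the value of `δ^k u` at a sequence is `u` of the
sequence with `c_k` omitted; for `k = n + 1` it is
`Φ(c_n ⟶ c_{n+1}) (u (c_0 ⟶ ⋯ ⟶ c_n))`. -/
def coface (n : ℕ) (k : Fin (n + 2)) : Cochain Φ n →ₗ[S] Cochain Φ (n + 1) where
  toFun u := fun σ => (Φ.map (faceToLast k σ)).hom (u (face k σ))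
  map_add' u u' := by ext σ; exact map_add _ _ _
  map_smul' r u := by ext σ; exact map_smul _ _ _

/-- The differential `δ = ∑_k (-1)^k δ^k`. -/
def coboundary (n : ℕ) : Cochain Φ n →ₗ[S] Cochain Φ (n + 1) :=
  ∑ k : Fin (n + 2), (-1 : ℤ) ^ (k : ℕ) • coface Φ n k

theorem coface_apply (n : ℕ) (k : Fin (n + 2)) (u : Cochain Φ n) (σ : ComposableArrows C (n + 1)) :
    coface Φ n k u σ = (Φ.map (faceToLast k σ)).hom (u (face k σ)) := rfl

/-- The cosimplicial identities. -/
theorem coface_comp_coface (n : ℕ) (i j : Fin (n + 2)) (h : i ≤ j) :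
    coface Φ (n + 1) j.succ ∘ₗ coface Φ n i = coface Φ (n + 1) i.castSucc ∘ₗ coface Φ n j := by
  ext u σ
  have e : ∀ x, j.succ.succAbove (i.succAbove x) = i.castSucc.succAbove (j.succAbove x) := fun x =>
    congrArg (fun f => (SimplexCategory.Hom.toOrderHom f) x)
      (SimplexCategory.δ_comp_δ (n := n) h)
  have e1 : ∀ (k : Fin (n + 3)) (l : Fin (n + 2)),
      (Φ.map (faceToLast k σ)).hom ((Φ.map (faceToLast l (face k σ))).hom
        (u (face l (face k σ)))) =
      (Φ.map (faceToLast l (face k σ) ≫ faceToLast k σ)).hom (u (face l (face k σ))) := by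
    intro k l
    rw [Φ.map_comp]
    rfl
  refine (e1 j.succ i).trans (Eq.trans ?_ (e1 i.castSucc j).symm)
  have hF : ((Fin.succAboveOrderEmb i).monotone.functor ⋙
        (Fin.succAboveOrderEmb j.succ).monotone.functor) =
      ((Fin.succAboveOrderEmb j).monotone.functor ⋙
        (Fin.succAboveOrderEmb i.castSucc).monotone.functor) :=
    CategoryTheory.Functor.ext (fun x => e x) (fun _ _ _ => Subsingleton.elim _ _)
  have gen : ∀ (F G : Fin (n + 1) ⥤ Fin (n + 3)) (_ : F = G)
      (a : F.obj (Fin.last n) ⟶ Fin.last (n + 2)) (b : G.obj (Fin.last n) ⟶ Fin.last (n + 2)),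
      (Φ.map (σ.map a)).hom (u (F ⋙ σ)) = (Φ.map (σ.map b)).hom (u (G ⋙ σ)) := by
    rintro F _ rfl a b
    rw [Subsingleton.elim a b]
  refine Eq.trans ?_ ((gen _ _ hF (homOfLE (Fin.le_last _)) (homOfLE (Fin.le_last _))).trans ?_)
  · exact congrArg (fun f => (Φ.map f).hom (u (face i (face j.succ σ)))) (σ.map_comp _ _).symm
  · exact congrArg (fun f => (Φ.map f).hom (u (face j (face i.castSucc σ)))) (σ.map_comp _ _)

/-- `δ` is a differential. -/
theorem coboundary_comp_coboundary (n : ℕ) : coboundary Φ (n + 1) ∘ₗ coboundary Φ n = 0 := by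
  have expand : coboundary Φ (n + 1) ∘ₗ coboundary Φ n =
      ∑ i : Fin (n + 2), ∑ j : Fin (n + 3),
        ((-1 : ℤ) ^ (i : ℕ) * (-1 : ℤ) ^ (j : ℕ)) • (coface Φ (n + 1) j ∘ₗ coface Φ n i) := by
    refine LinearMap.ext fun u => ?_
    simp only [coboundary, LinearMap.comp_apply, LinearMap.sum_apply, LinearMap.smul_apply,
      map_sum, map_zsmul, Finset.smul_sum, smul_smul]
  rw [expand]
  simp only [← Finset.sum_product']
  let P := Fin (n + 2) × Fin (n + 3)
  let S : Finset P := {ij : P | (ij.2 : ℕ) ≤ (ij.1 : ℕ)}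
  rw [Finset.univ_product_univ, ← Finset.sum_add_sum_compl S, ← eq_neg_iff_add_eq_zero,
    ← Finset.sum_neg_distrib]
  let φ : ∀ ij : P, ij ∈ S → P := fun ij hij =>
    (Fin.castLT ij.2 (lt_of_le_of_lt (Finset.mem_filter.mp hij).right (Fin.is_lt ij.1)), ij.1.succ)
  apply Finset.sum_bij φ
  · intro ij hij
    simp_rw [S, φ, Finset.compl_filter, Finset.mem_filter_univ, Fin.val_succ,
      Fin.val_castLT] at hij ⊢
    lia
  · rintro ⟨i, j⟩ hij ⟨i', j'⟩ hij' h
    rw [Prod.mk_inj]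
    exact ⟨by simpa [φ] using! congr_arg Prod.snd h,
      by simpa [φ, Fin.castSucc_castLT] using! congr_arg Fin.castSucc (congr_arg Prod.fst h)⟩
  · rintro ⟨i', j'⟩ hij'
    simp_rw [S, Finset.compl_filter, Finset.mem_filter_univ, not_le] at hij'
    refine ⟨(j'.pred <| ?_, Fin.castSucc i'), ?_, ?_⟩
    · rintro rfl
      simp only [Fin.val_zero, not_lt_zero] at hij'
    · simpa [S] using! Nat.le_sub_one_of_lt hij'
    · simp only [φ, Fin.castLT_castSucc, Fin.succ_pred]
  · rintro ⟨i, j⟩ hij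
    have hij' : (j : ℕ) ≤ (i : ℕ) := by simpa [S] using! hij
    have key := coface_comp_coface Φ n (φ ⟨i, j⟩ hij).1 i
      (by simpa [φ, Fin.le_def] using! hij')
    simp only [φ, Fin.castSucc_castLT] at key
    simp only [← neg_smul, φ]
    rw [key]
    congr 1
    simp only [Fin.val_succ, pow_add, pow_one, mul_neg, neg_neg, mul_one, Fin.val_castLT]
    try apply mul_comm

/-- The higher limits `lim^{i} Φ` for `i = n + 1 ≥ 1`: the cohomology of the cochain complex in
degree `n + 1`, i.e. cocycles of degree `n + 1` modulo coboundaries. -/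
abbrev HigherLimitSucc (n : ℕ) : Type _ :=
  LinearMap.ker (coboundary Φ (n + 1)) ⧸
    (LinearMap.range (coboundary Φ n)).submoduleOf (LinearMap.ker (coboundary Φ (n + 1)))

variable {Φ}

/-- A cone over `Φ` consists of an object `M` and a natural transformation `1_M ⟶ Φ` from the
constant functor. This is the induced linear map `ρ : M ⟶ lim Φ`, where the limit is realised as
the submodule of compatible families in `∏_c Φ(c)`. -/
def toLimit (s : Cone Φ) : s.pt →ₗ[S] ModuleCat.sectionsSubmodule Φ where
  toFun m := ⟨fun c => (s.π.app c).hom m, fun {c c'} f => by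
    have h := congrArg (fun g => g.hom m) (s.w f)
    exact h⟩
  map_add' m m' := by
    apply Subtype.ext
    funext c
    exact map_add _ _ _
  map_smul' r m := by
    apply Subtype.ext
    funext c
    exact map_smul _ _ _

/-- The module `L^{-1}(M, Φ)`, the kernel of `ρ : M ⟶ lim Φ`. -/
abbrev LNegOne (s : Cone Φ) : Type _ := LinearMap.ker (toLimit s)

/-- The module `L^0(M, Φ)`, the cokernel of `ρ : M ⟶ lim Φ`. -/
abbrev LZero (s : Cone Φ) : Type _ :=
  ModuleCat.sectionsSubmodule Φ ⧸ LinearMap.range (toLimit s)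

/-- All modules `L^i(M, Φ)`, `i ≥ -1`, vanish (where `L^i = lim^i Φ` for `i ≥ 1`). -/
def AllLVanish (s : Cone Φ) : Prop :=
  Subsingleton (LNegOne s) ∧ Subsingleton (LZero s) ∧ ∀ n, Subsingleton (HigherLimitSucc Φ n)

end Complex

/-! ### Depth over a local ring -/

/-- The depth of a module over a local ring: the supremum of the lengths of the sequences of
elements of the maximal ideal that are regular on `N`, meaning that the `i`-th element is not a
zero divisor on `N / (x_1, …, x_{i-1}) N` for all `i`. The zero module has depth `⊤`. -/
noncomputable def localDepth (R : Type u) [CommRing R] [IsLocalRing R]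
    (N : Type w) [AddCommGroup N] [Module R N] : ℕ∞ :=
  ⨆ (xs : List R) (_ : (∀ x ∈ xs, x ∈ IsLocalRing.maximalIdeal R) ∧
    RingTheory.Sequence.IsWeaklyRegular N xs), (xs.length : ℕ∞)

/-! ### Graded modules over a graded algebra -/

section Graded

variable {F : Type u'} [Field F] {R : Type u} [Ring R] [Algebra F R]

/-- `R` is connected: `R^0 = F`. -/
def IsConnectedGrading (𝒜 : ℕ → Submodule F R) : Prop :=
  Function.Injective (algebraMap F R) ∧ ∀ r : R, r ∈ 𝒜 0 ↔ ∃ a : F, algebraMap F R a = r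

/-- `R` is graded-commutative: `x y = (-1)^{ij} y x` for `x` of degree `i` and `y` of degree
`j`. -/
def IsGradedCommutative (𝒜 : ℕ → Submodule F R) : Prop :=
  ∀ (i j : ℕ) (x y : R), x ∈ 𝒜 i → y ∈ 𝒜 j → x * y = (-1) ^ (i * j) * (y * x)

/-- A finitely generated non-negatively graded (left) module over the graded algebra `(R, 𝒜)`. -/
structure GradedFGMod (𝒜 : ℕ → Submodule F R) [GradedAlgebra 𝒜] where
  carrier : Type w
  [addCommGroup : AddCommGroup carrier]
  [module : Module R carrier]
  [moduleBase : Module F carrier]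
  [isScalarTower : IsScalarTower F R carrier]
  [finite : Module.Finite R carrier]
  /-- the homogeneous parts -/
  grading : ℕ → Submodule F carrier
  [decomposition : DirectSum.Decomposition grading]
  [gradedSMul : SetLike.GradedSMul 𝒜 grading]

attribute [instance] GradedFGMod.addCommGroup GradedFGMod.module GradedFGMod.moduleBase
  GradedFGMod.isScalarTower GradedFGMod.finite GradedFGMod.decomposition GradedFGMod.gradedSMul

variable {𝒜 : ℕ → Submodule F R} [GradedAlgebra 𝒜]

namespace GradedFGMod

/-- Morphisms of graded modules: `R`-linear maps that preserve degrees. -/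
@[ext]
structure Hom (N N' : GradedFGMod.{u, u', w} 𝒜) where
  toLinearMap : N.carrier →ₗ[R] N'.carrier
  map_mem : ∀ (d : ℕ) (m : N.carrier), m ∈ N.grading d → toLinearMap m ∈ N'.grading d

instance : Category (GradedFGMod.{u, u', w} 𝒜) where
  Hom N N' := Hom N N'
  id N := ⟨LinearMap.id, fun _ _ h => h⟩
  comp f g := ⟨g.toLinearMap ∘ₗ f.toLinearMap, fun d _ h => g.map_mem d _ (f.map_mem d _ h)⟩

/-- The functor sending a graded module to its homogeneous part of degree `d`, an `F`-vector
space. -/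
def degreePart (𝒜 : ℕ → Submodule F R) [GradedAlgebra 𝒜] (d : ℕ) :
    GradedFGMod.{u, u', w} 𝒜 ⥤ ModuleCat.{w} F where
  obj N := ModuleCat.of F (N.grading d)
  map {N N'} f := ModuleCat.ofHom
    ((f.toLinearMap.restrictScalars F).restrict (fun m hm => f.map_mem d m hm))

end GradedFGMod

/-- Limits and products of graded modules are formed degreewise, so the homogeneous part of degree
`d` of the graded `R`-module `L^i(M, Φ)` is `L^i` of the functor of homogeneous parts of degree
`d`. All `L^i(M, Φ)`, `i ≥ -1`, vanish if and only if all their homogeneous parts do. -/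
def GradedAllLVanish {C : Type w'} [Category.{v} C] {Φ : C ⥤ GradedFGMod.{u, u', w} 𝒜}
    (s : Cone Φ) : Prop :=
  ∀ d : ℕ, AllLVanish ((GradedFGMod.degreePart 𝒜 d).mapCone s)

/-- A sequence `x_1, …, x_r` in a ring `R` (possibly noncommutative) is regular on the left module
`N` if for all `i` the element `x_i` is not a zero divisor on `N / (x_1, …, x_{i-1}) N`. -/
def IsRegularOn (N : Type w) [AddCommGroup N] [Module R N] (xs : List R) : Prop :=
  ∀ (i : ℕ) (h : i < xs.length),
    IsSMulRegular (N ⧸ (Ideal.ofList (xs.take i) • ⊤ : Submodule R N)) xs[i]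

/-- The depth of a graded module over a connected graded algebra: the supremum of the lengths of the
sequences of homogeneous elements of the maximal ideal `R^+` (homogeneous elements of positive
degree) that are regular on `N`. The zero module has depth `⊤`. -/
noncomputable def gradedDepth (𝒜 : ℕ → Submodule F R) (N : Type w) [AddCommGroup N]
    [Module R N] : ℕ∞ :=
  ⨆ (xs : List R) (_ : (∀ x ∈ xs, ∃ d, 0 < d ∧ x ∈ 𝒜 d) ∧ IsRegularOn N xs), (xs.length : ℕ∞)

end Graded

end HigherLimits

/-! The vanishing of all `L^i` says that `0 → M → C^0 → C^1 → ⋯` is exact, and each `C^n` is a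
product of modules `Φ(c)`. Depth is carried from the `Φ(c)` to `M` through a cohomological criterion
that needs no finiteness on one side, because the `C^n` are in general not finitely generated.

The criterion uses the complex `opDiff` of all functions `σ^j → N`, where `σ` is the whole set of
available multipliers. It plays the role of `Ext^j(R/m, N)`: for finitely generated `N`, depth at
least `r` is equivalent to vanishing in degrees `< r` (`OpAcyclic`). A regular sequence of length
`r` gives acyclicity below `r` (`OpAcyclic.of_quotient`, once per element). Conversely, vanishing in
degree `0` means that no nonzero element is killed by all multipliers; associated primes and prime
avoidance then give a regular multiplier, and dividing by it costs one degree
(`OpAcyclic.quotient`). Acyclicity passes to products (`OpAcyclic.pi`) and along the resolution to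
`M` by dimension shifting (`OpAcyclic.of_exact`).

In the graded case the multipliers are the central homogeneous elements of positive degree, acting
on the product of the homogeneous parts, in accordance with degreewise limits. Noncentral
homogeneous elements have square zero, so they are regular only on the zero module. -/

namespace HigherLimits

/-! ### The complex of a family of commuting operators -/

section OperatorComplex

variable {σ : Type*} {N N' : Type*} [AddCommGroup N] [AddCommGroup N']
  (op : σ → AddMonoid.End N) (op' : σ → AddMonoid.End N')

/-- The differential of the Koszul type complex of a family of operators: its `j`-cochains are all
functions `σ^j → N`, and `(d u)(s_0, …, s_j) = ∑ (-1)^k s_k u(s_0, …, ŝ_k, …, s_j)`. -/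
def opDiff : ∀ j : ℕ, ((Fin j → σ) → N) → ((Fin (j + 1) → σ) → N)
  | 0, u => fun s => op (s 0) (u (Fin.tail s))
  | j + 1, u => fun s =>
      op (s 0) (u (Fin.tail s)) - opDiff j (fun t => u (Fin.cons (s 0) t)) (Fin.tail s)

/-- A cochain is a boundary. -/
def IsOpBoundary : ∀ j : ℕ, ((Fin j → σ) → N) → Prop
  | 0, u => u = 0
  | j + 1, u => ∃ v, opDiff op j v = u

/-- The complex of the operators has no cohomology in degrees less than `r`. -/
def OpAcyclic (r : ℕ) : Prop :=
  ∀ j < r, ∀ u, opDiff op j u = 0 → IsOpBoundary op j u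

theorem opDiff_zero_cons (u : (Fin 0 → σ) → N) (x : σ) (t : Fin 0 → σ) :
    opDiff op 0 u (Fin.cons x t) = op x (u t) := by
  simp [opDiff]

theorem opDiff_succ_cons (j : ℕ) (u : (Fin (j + 1) → σ) → N) (x : σ) (t : Fin (j + 1) → σ) :
    opDiff op (j + 1) u (Fin.cons x t) =
      op x (u t) - opDiff op j (fun t => u (Fin.cons x t)) t := by
  simp [opDiff]

variable {op op'}

theorem cochain_ext {σ N : Type*} {j : ℕ} {u v : (Fin (j + 1) → σ) → N}
    (h : ∀ x t, u (Fin.cons x t) = v (Fin.cons x t)) : u = v := by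
  funext s
  rw [← Fin.cons_self_tail s]
  exact h _ _

theorem opDiff_map (f : N →+ N') (hf : ∀ s n, f (op s n) = op' s (f n)) (j : ℕ)
    (u : (Fin j → σ) → N) : (fun t => f (opDiff op j u t)) = opDiff op' j (fun t => f (u t)) := by
  induction j with
  | zero => exact cochain_ext fun x t => by rw [opDiff_zero_cons, opDiff_zero_cons, hf]
  | succ j ih =>
    refine cochain_ext fun x t => ?_
    rw [opDiff_succ_cons, opDiff_succ_cons, map_sub, hf, ← ih]

theorem opDiff_op (hc : ∀ s t n, op s (op t n) = op t (op s n)) (x : σ) (j : ℕ)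
    (u : (Fin j → σ) → N) (t : Fin (j + 1) → σ) :
    op x (opDiff op j u t) = opDiff op j (fun t => op x (u t)) t :=
  congrFun (opDiff_map (op x : N →+ N) (hc x) j u) t

theorem opDiff_sub (j : ℕ) (u v : (Fin j → σ) → N) :
    opDiff op j (fun t => u t - v t) = fun t => opDiff op j u t - opDiff op j v t := by
  induction j with
  | zero => exact cochain_ext fun x t => by simp only [opDiff_zero_cons, map_sub]
  | succ j ih =>
    refine cochain_ext fun x t => ?_
    simp only [opDiff_succ_cons, map_sub, ih]
    abel

/-- Evaluated at a first argument `x`, the two terms `x · d u` cancel because the operators commute;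
what remains is `d d` of `u(x, ·)`, one degree lower. -/
theorem opDiff_opDiff (hc : ∀ s t n, op s (op t n) = op t (op s n)) (j : ℕ)
    (u : (Fin j → σ) → N) : opDiff op (j + 1) (opDiff op j u) = 0 := by
  induction j with
  | zero =>
    refine cochain_ext fun x t => ?_
    rw [← Fin.cons_self_tail t]
    simp only [opDiff_succ_cons, opDiff_zero_cons, Pi.zero_apply]
    rw [hc, sub_self]
  | succ j ih =>
    refine cochain_ext fun x t => ?_
    have h : (fun t => opDiff op (j + 1) u (Fin.cons x t)) =
        fun t => op x (u t) - opDiff op j (fun t => u (Fin.cons x t)) t :=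
      funext fun t => opDiff_succ_cons op j u x t
    rw [opDiff_succ_cons, h, opDiff_sub, ih, opDiff_op hc]
    simp

theorem OpAcyclic.mono {r r' : ℕ} (h : OpAcyclic op r) (hr : r' ≤ r) : OpAcyclic op r' :=
  fun j hj => h j (hj.trans_le hr)

theorem opAcyclic_of_subsingleton [Subsingleton N] (r : ℕ) : OpAcyclic op r := by
  rintro (_ | j) - u -
  · exact Subsingleton.elim _ _
  · exact ⟨0, Subsingleton.elim _ _⟩

/-- Vanishing of the cohomology in degree zero. -/
theorem OpAcyclic.eq_zero {r : ℕ} (h : OpAcyclic op (r + 1)) {n : N} (hn : ∀ s, op s n = 0) :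
    n = 0 := by
  have : (fun _ : Fin 0 → σ => n) = 0 :=
    h 0 r.succ_pos _ (cochain_ext fun x t => by rw [opDiff_zero_cons, hn]; rfl)
  exact congrFun this Fin.elim0

/-- Primitives are chosen in each factor separately. Different factors may have unrelated regular
sequences; acyclicity avoids choosing a common one, since it refers to all multipliers at once. -/
theorem OpAcyclic.pi {ι : Type*} {X : ι → Type*} [∀ i, AddCommGroup (X i)]
    {opX : ∀ i, σ → AddMonoid.End (X i)} {opP : σ → AddMonoid.End (∀ i, X i)}
    (hop : ∀ s u i, opP s u i = opX i s (u i)) {r : ℕ} (h : ∀ i, OpAcyclic (opX i) r) :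
    OpAcyclic opP r := by
  have key : ∀ i j (u : (Fin j → σ) → ∀ i, X i) t,
      opDiff opP j u t i = opDiff (opX i) j (fun t => u t i) t := fun i j u t =>
    congrFun (opDiff_map (Pi.evalAddMonoidHom X i) (fun s n => hop s n i) j u) t
  intro j hj u hu
  have hi : ∀ i, IsOpBoundary (opX i) j (fun t => u t i) := fun i =>
    h i j hj _ (funext fun t => by rw [← key, hu]; rfl)
  cases j with
  | zero => exact funext fun t => funext fun i => congrFun (hi i) t
  | succ j =>
    choose v hv using hi
    exact ⟨fun t i => v i t, funext fun t => funext fun i => by rw [key, hv]⟩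

theorem OpAcyclic.of_bijective (f : N →+ N') (hf : ∀ s n, f (op s n) = op' s (f n))
    (hb : Function.Bijective f) {r : ℕ} (h : OpAcyclic op r) : OpAcyclic op' r := by
  intro j hj u hu
  obtain ⟨g, hg⟩ := hb.2.hasRightInverse
  have hgu : (fun t => f (g (u t))) = u := funext fun t => hg _
  have h1 : opDiff op j (fun t => g (u t)) = 0 := by
    refine funext fun t => hb.1 ?_
    rw [congrFun (opDiff_map f hf j _) t, hgu, hu]
    exact (map_zero f).symm
  have h2 := h j hj _ h1
  cases j with
  | zero =>
    refine funext fun t => ?_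
    rw [← hg (u t), congrFun h2 t]
    exact map_zero f
  | succ j =>
    obtain ⟨v, hv⟩ := h2
    refine ⟨fun t => f (v t), ?_⟩
    rw [← opDiff_map f hf, hv, hgu]

theorem OpAcyclic.iff_of_bijective (f : N →+ N') (hf : ∀ s n, f (op s n) = op' s (f n))
    (hb : Function.Bijective f) {r : ℕ} : OpAcyclic op r ↔ OpAcyclic op' r := by
  refine ⟨OpAcyclic.of_bijective f hf hb, fun h => ?_⟩
  let e := AddEquiv.ofBijective f hb
  refine OpAcyclic.of_bijective e.symm.toAddMonoidHom (fun s n => ?_) e.symm.bijective h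
  obtain ⟨n, rfl⟩ := e.surjective n
  have h1 : op' s (e n) = e (op s n) := (hf s n).symm
  simp [h1]

/-- If `0 → M → X^0 → X^1 → ⋯` is exact and the complexes of all `X^n` are acyclic in degrees less
than `r`, then so is the complex of `M`. -/
theorem OpAcyclic.of_exact {X : ℕ → Type*} [∀ n, AddCommGroup (X n)]
    {opX : ∀ n, σ → AddMonoid.End (X n)} (f : ∀ n, X n →+ X (n + 1))
    (hcX : ∀ n s t x, opX n s (opX n t x) = opX n t (opX n s x))
    (hf : ∀ n s x, f n (opX n s x) = opX (n + 1) s (f n x))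
    (hff : ∀ n x, f (n + 1) (f n x) = 0)
    (hex : ∀ n x, f (n + 1) x = 0 → ∃ y, f n y = x)
    (e : N →+ X 0) (he : ∀ s n, e (op s n) = opX 0 s (e n)) (hinj : Function.Injective e)
    (hfe : ∀ n, f 0 (e n) = 0) (hex' : ∀ x, f 0 x = 0 → ∃ n, e n = x)
    {r : ℕ} (h : ∀ n, OpAcyclic (opX n) r) : OpAcyclic op r := by
  -- Dimension shifting: a cocycle of positive degree with values in `ker (f n)` has a primitive
  -- with values in `ker (f n)`. An arbitrary primitive `v` is corrected by `d w'`, where `w'` lifts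
  -- a primitive of `f n ∘ v` found one step further along the resolution and one degree lower.
  have key : ∀ j, j + 1 < r → ∀ n (u : (Fin (j + 1) → σ) → X n), opDiff (opX n) (j + 1) u = 0 →
      (∀ t, f n (u t) = 0) → ∃ v, opDiff (opX n) j v = u ∧ ∀ t, f n (v t) = 0 := by
    intro j
    induction j with
    | zero =>
      intro hj n u hu hfu
      obtain ⟨v, hv⟩ := h n _ hj u hu
      refine ⟨v, hv, fun t => congrFun (h (n + 1) 0 (by omega) (fun t => f n (v t)) ?_) t⟩
      rw [← opDiff_map (f n) (hf n), hv]
      exact funext hfu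
    | succ j ih =>
      intro hj n u hu hfu
      obtain ⟨v, hv⟩ := h n _ hj u hu
      obtain ⟨w, hw, hfw⟩ := ih (by omega) (n + 1) (fun t => f n (v t))
        (by rw [← opDiff_map (f n) (hf n), hv]; exact funext hfu) (fun t => hff n _)
      choose w' hw' using fun t => hex n (w t) (hfw t)
      refine ⟨fun t => v t - opDiff (opX n) j w' t, ?_, fun t => ?_⟩
      · rw [opDiff_sub, opDiff_opDiff (hcX n), hv]
        simp
      · rw [map_sub, congrFun (opDiff_map (f n) (hf n) j w') t, funext hw', hw, sub_self]
  intro j hj u hu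
  have hu' : opDiff (opX 0) j (fun t => e (u t)) = 0 := by
    rw [← opDiff_map e he, hu]
    exact funext fun _ => map_zero e
  cases j with
  | zero =>
    refine funext fun t => hinj ?_
    rw [congrFun (h 0 0 hj _ hu') t]
    exact (map_zero e).symm
  | succ j =>
    obtain ⟨v, hv, hfv⟩ := key j hj 0 _ hu' (fun t => hfe _)
    choose v' hv' using fun t => hex' (v t) (hfv t)
    refine ⟨v', funext fun t => hinj ?_⟩
    rw [congrFun (opDiff_map e he j v') t, funext hv', hv]

/-! ### Passing to the quotient by an injective operator -/

section Quotient

variable (hc : ∀ s t n, op s (op t n) = op t (op s n)) (x : σ)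
  (hx : Function.Injective (op x)) (q : N →+ N') (hq : ∀ s n, q (op s n) = op' s (q n))
  (hsurj : Function.Surjective q) (hker : ∀ n, q n = 0 ↔ ∃ n', op x n' = n)

include hc hx hq hsurj hker

/-- If `x` is injective on `N` and the complex of `N / x N` is acyclic in degrees less than `r`,
then the complex of `N` is acyclic in degrees less than `r + 1`. -/
theorem OpAcyclic.of_quotient {r : ℕ} (h : OpAcyclic op' r) : OpAcyclic op (r + 1) := by
  have hx0 : ∀ {n}, op x n = 0 → n = 0 := fun hn => hx (hn.trans (map_zero (op x)).symm)
  rintro (_ | j) hj u hu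
  · refine funext fun t => hx0 ?_
    rw [← opDiff_zero_cons op u x t, hu]
    rfl
  -- The cocycle condition with first argument `x` shows that `u(x, ·)` is a contraction for
  -- multiplication by `x`; in particular it is a cocycle modulo `x`.
  · have h1 : opDiff op j (fun t => u (Fin.cons x t)) = fun t => op x (u t) := funext fun t => by
      have := congrFun hu (Fin.cons x t)
      rw [opDiff_succ_cons] at this
      exact (sub_eq_zero.1 this).symm
    have h2 := h j (by omega) (fun t => q (u (Fin.cons x t))) (by
      rw [← opDiff_map q hq, h1]
      exact funext fun t => (hker _).2 ⟨_, rfl⟩)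
    -- If a cocycle `z` agrees with `u(x, ·)` modulo `x`, write `u(x, ·) - z = x v`. Then `x · d v =
    -- x · u`, and `x` can be cancelled.
    have main : ∀ (z : (Fin j → σ) → N), opDiff op j z = 0 →
        (∀ t, q (u (Fin.cons x t) - z t) = 0) → IsOpBoundary op (j + 1) u := by
      intro z hz hzu
      choose v hv using fun t => (hker _).1 (hzu t)
      refine ⟨v, funext fun t => hx ?_⟩
      rw [opDiff_op hc, funext hv, opDiff_sub, hz, h1]
      simp
    cases j with
    | zero =>
      refine main 0 (cochain_ext fun x t => by rw [opDiff_zero_cons]; exact map_zero _) fun t => ?_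
      rw [Pi.zero_apply, sub_zero]
      exact congrFun h2 t
    | succ j =>
      obtain ⟨w, hw⟩ := h2
      choose w' hw' using fun t => hsurj (w t)
      refine main (opDiff op j w') (opDiff_opDiff hc j w') fun t => ?_
      rw [map_sub, congrFun (opDiff_map q hq j w') t, funext hw', hw, sub_self]

/-- If `x` is injective on `N` and the complex of `N` is acyclic in degrees less than `r + 1`,
then the complex of `N / x N` is acyclic in degrees less than `r`. -/
theorem OpAcyclic.quotient {r : ℕ} (h : OpAcyclic op (r + 1)) : OpAcyclic op' r := by
  have hx0 : ∀ {n}, op x n = 0 → n = 0 := fun hn => hx (hn.trans (map_zero (op x)).symm)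
  have hqx : ∀ n, q (op x n) = 0 := fun n => (hker _).2 ⟨_, rfl⟩
  intro j hj u hu
  choose u' hu' using fun t => hsurj (u t)
  have h1 : ∀ t, q (opDiff op j u' t) = 0 := fun t => by
    rw [congrFun (opDiff_map q hq j u') t, funext hu', hu]
    rfl
  -- The connecting homomorphism: `d u' = x v` with `v` a cocycle of degree `j + 1`, hence `v = d
  -- w`, and `u' - x w` is a cocycle that still lifts `u`.
  choose v hv using fun t => (hker _).1 (h1 t)
  have h2 : opDiff op (j + 1) v = 0 := funext fun t => hx0 <| by
    rw [opDiff_op hc, funext hv, opDiff_opDiff hc]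
    rfl
  obtain ⟨w, hw⟩ := h (j + 1) (by omega) v h2
  have h3 := h j (by omega) (fun t => u' t - op x (w t)) (by
    rw [opDiff_sub]
    exact funext fun t => by rw [← opDiff_op hc, hw, hv, sub_self]; rfl)
  cases j with
  | zero =>
    refine funext fun t => ?_
    rw [← hu', ← sub_zero (q (u' t)), ← hqx (w t), ← map_sub, congrFun h3 t]
    exact map_zero q
  | succ j =>
    obtain ⟨z, hz⟩ := h3
    refine ⟨fun t => q (z t), ?_⟩
    rw [← opDiff_map q hq, hz]
    exact funext fun t => by rw [map_sub, hqx, sub_zero, hu']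

end Quotient

end OperatorComplex

/-! ### Exactness of the augmented cochain complex -/

section Exactness

variable {S : Type u} [Ring S] {C : Type w} [Category.{v} C] {Φ : C ⥤ ModuleCat.{w'} S}

/-- The augmentation `M → C^0(𝒞, Φ)` of the cochain complex. -/
def augmentation (s : Cone Φ) : s.pt →ₗ[S] Cochain Φ 0 :=
  LinearMap.pi fun σ => (s.π.app (σ.obj (Fin.last 0))).hom

theorem augmentation_apply (s : Cone Φ) (m : s.pt) (σ : ComposableArrows C 0) :
    augmentation s m σ = (s.π.app (σ.obj (Fin.last 0))).hom m := rfl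

theorem coboundary_apply (n : ℕ) (u : Cochain Φ n) (σ : ComposableArrows C (n + 1)) :
    coboundary Φ n u σ = ∑ k : Fin (n + 2),
      (-1 : ℤ) ^ (k : ℕ) • (Φ.map (faceToLast k σ)).hom (u (face k σ)) := by
  simp [coboundary, coface_apply]

theorem coboundary_zero_apply (u : Cochain Φ 0) (σ : ComposableArrows C 1) :
    coboundary Φ 0 u σ = (Φ.map (faceToLast 0 σ)).hom (u (face 0 σ)) -
      (Φ.map (faceToLast 1 σ)).hom (u (face 1 σ)) := by
  rw [coboundary_apply, Fin.sum_univ_two]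
  simp [sub_eq_add_neg]

/-- The faces of `mk₁ f` are used through propositional equalities with `mk₀`, so the dependent
value of `u` has to be transported along them. -/
theorem map_hom_eq_of_eq_mk₀ (u : Cochain Φ 0) {F : ComposableArrows C 0} {X Y : C}
    (hF : F = ComposableArrows.mk₀ Y) (a : F.obj (Fin.last 0) ⟶ X)
    (b : (ComposableArrows.mk₀ Y).obj (Fin.last 0) ⟶ X)
    (hab : eqToHom (by rw [hF]) ≫ a = b) :
    (Φ.map a).hom (u F) = (Φ.map b).hom (u (ComposableArrows.mk₀ Y)) := by
  subst hF hab
  simp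

theorem coboundary_zero_mk₁ (u : Cochain Φ 0) {X Y : C} (f : X ⟶ Y) :
    coboundary Φ 0 u (ComposableArrows.mk₁ f) =
      (Φ.map (𝟙 Y)).hom (u (ComposableArrows.mk₀ Y)) -
        (Φ.map f).hom (u (ComposableArrows.mk₀ X)) := by
  have h0 : face 0 (ComposableArrows.mk₁ f) = ComposableArrows.mk₀ Y :=
    ComposableArrows.ext₀ rfl
  have h1 : face 1 (ComposableArrows.mk₁ f) = ComposableArrows.mk₀ X :=
    ComposableArrows.ext₀ rfl
  rw [coboundary_zero_apply]
  congr 1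
  · exact map_hom_eq_of_eq_mk₀ u h0 _ (𝟙 Y) ((Category.id_comp _).trans rfl)
  · exact map_hom_eq_of_eq_mk₀ u h1 _ f ((Category.id_comp _).trans rfl)

theorem coboundary_augmentation (s : Cone Φ) (m : s.pt) : coboundary Φ 0 (augmentation s m) = 0 := by
  funext σ
  rw [coboundary_zero_apply, augmentation_apply, augmentation_apply]
  have h : ∀ {X Y : C} (f : X ⟶ Y), (Φ.map f).hom ((s.π.app X).hom m) = (s.π.app Y).hom m :=
    fun f => congrArg (fun g => g.hom m) (s.w f)
  rw [h, h, sub_self]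
  rfl

theorem coboundary_coboundary (n : ℕ) (u : Cochain Φ n) :
    coboundary Φ (n + 1) (coboundary Φ n u) = 0 :=
  LinearMap.congr_fun (coboundary_comp_coboundary Φ n) u

variable {s : Cone Φ}

theorem AllLVanish.augmentation_injective (h : AllLVanish s) :
    Function.Injective (augmentation s) := by
  refine (injective_iff_map_eq_zero _).2 fun m hm => ?_
  have hm' : m ∈ LinearMap.ker (toLimit s) :=
    Subtype.ext (funext fun c => congrFun hm (ComposableArrows.mk₀ c))
  exact congrArg Subtype.val (h.1.elim ⟨m, hm'⟩ 0)

/-- A `0`-cocycle is a compatible family, that is, an element of the limit, and `L^0 = 0` makes `ρ`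
surjective. -/
theorem AllLVanish.exists_augmentation_eq (h : AllLVanish s) {u : Cochain Φ 0}
    (hu : coboundary Φ 0 u = 0) : ∃ m, augmentation s m = u := by
  have h1 : ∀ {X Y : C} (f : X ⟶ Y), (Φ.map f).hom (u (ComposableArrows.mk₀ X)) =
      u (ComposableArrows.mk₀ Y) := fun {X Y} f => by
    have h := sub_eq_zero.1 ((coboundary_zero_mk₁ u f).symm.trans (congrFun hu _))
    rw [Φ.map_id] at h
    exact h.symm
  have h2 : (⟨fun c => u (ComposableArrows.mk₀ c), fun f => h1 f⟩ : ModuleCat.sectionsSubmodule Φ) ∈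
      LinearMap.range (toLimit s) :=
    (Submodule.Quotient.mk_eq_zero _).1 (h.2.1.elim _ _)
  obtain ⟨m, hm⟩ := h2
  refine ⟨m, funext fun σ => ?_⟩
  obtain ⟨X, rfl⟩ := ComposableArrows.mk₀_surjective σ
  exact congrFun (congrArg Subtype.val hm) X

theorem AllLVanish.exists_coboundary_eq (h : AllLVanish s) {n : ℕ} {u : Cochain Φ (n + 1)}
    (hu : coboundary Φ (n + 1) u = 0) : ∃ v, coboundary Φ n v = u := by
  have : (⟨u, hu⟩ : LinearMap.ker (coboundary Φ (n + 1))) ∈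
      (LinearMap.range (coboundary Φ n)).submoduleOf (LinearMap.ker (coboundary Φ (n + 1))) :=
    (Submodule.Quotient.mk_eq_zero _).1 ((h.2.2 n).elim _ _)
  exact this

end Exactness

/-! ### Regular sequences of central elements -/

section Central

variable {R : Type u} [Ring R] {N : Type w} [AddCommGroup N] [Module R N]

theorem ofList_append_smul_top (l₁ l₂ : List R) :
    (Ideal.ofList (l₁ ++ l₂) • ⊤ : Submodule R N) =
      Ideal.ofList l₁ • ⊤ ⊔ Ideal.ofList l₂ • ⊤ := by
  rw [Ideal.ofList_append, Submodule.sup_smul]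

/-- Elements of the left ideal `R x` act as `(a x) m`; centrality of `x` rewrites this as `x (a m)`.
-/
theorem mem_ofList_singleton_smul_top {x : R} (hx : x ∈ Set.center R) {n : N} :
    n ∈ (Ideal.ofList [x] • ⊤ : Submodule R N) ↔ ∃ n', x • n' = n := by
  constructor
  · intro h
    refine Submodule.smul_induction_on h (fun r hr m _ => ?_) ?_
    · rw [Ideal.ofList_singleton, Ideal.mem_span_singleton'] at hr
      obtain ⟨a, rfl⟩ := hr
      exact ⟨a • m, by rw [smul_smul, (Set.mem_center_iff.1 hx).comm a]⟩
    · rintro _ _ ⟨a, rfl⟩ ⟨b, rfl⟩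
      exact ⟨a + b, smul_add _ _ _⟩
  · rintro ⟨n', rfl⟩
    exact Submodule.smul_mem_smul (Ideal.subset_span (List.mem_singleton_self x)) trivial

theorem mem_ofList_append_singleton_smul_top {l : List R} {x : R} (hx : x ∈ Set.center R) {n : N} :
    n ∈ (Ideal.ofList (l ++ [x]) • ⊤ : Submodule R N) ↔
      ∃ n', n - x • n' ∈ (Ideal.ofList l • ⊤ : Submodule R N) := by
  rw [ofList_append_smul_top, Submodule.mem_sup]
  constructor
  · rintro ⟨p, hp, y, hy, rfl⟩
    obtain ⟨n', rfl⟩ := (mem_ofList_singleton_smul_top hx).1 hy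
    exact ⟨n', by rwa [add_sub_cancel_right]⟩
  · rintro ⟨n', h⟩
    exact ⟨_, h, _, (mem_ofList_singleton_smul_top hx).2 ⟨n', rfl⟩, sub_add_cancel _ _⟩

theorem IsRegularOn.append_singleton {l : List R} {x : R} (h : IsRegularOn N l)
    (hx : IsSMulRegular (N ⧸ (Ideal.ofList l • ⊤ : Submodule R N)) x) :
    IsRegularOn N (l ++ [x]) := by
  intro i hi
  rcases lt_or_ge i l.length with hil | hil
  · rw [List.getElem_append_left hil, List.take_append_of_le_length hil.le]
    exact h i hil
  · obtain rfl : i = l.length := by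
      simp only [List.length_append, List.length_singleton] at hi
      omega
    have h1 : (l ++ [x]).take l.length = l := by simp
    rw [h1]
    simpa using hx

end Central

/-- The supremum may be infinite, but a finite lower bound is always reached by a single sequence,
since exceeding `r` means having length at least `r + 1`. -/
theorem exists_le_length_of_le_iSup {R : Type*} {p : List R → Prop} (hnil : p []) {r : ℕ}
    (h : (r : ℕ∞) ≤ ⨆ (xs : List R) (_ : p xs), (xs.length : ℕ∞)) :
    ∃ xs, p xs ∧ r ≤ xs.length := by
  cases r with
  | zero => exact ⟨[], hnil, Nat.zero_le _⟩
  | succ r =>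
    have h1 : (r : ℕ∞) < ⨆ (xs : List R) (_ : p xs), (xs.length : ℕ∞) :=
      lt_of_lt_of_le (by exact_mod_cast r.lt_succ_self) h
    obtain ⟨xs, h2⟩ := lt_iSup_iff.1 h1
    obtain ⟨hp, h3⟩ := lt_iSup_iff.1 h2
    exact ⟨xs, hp, by exact_mod_cast h3⟩

section Central

variable {R : Type u} [Ring R] {N : Type w} [AddCommGroup N] [Module R N]

theorem ofList_smul_top_le_append (l₁ l₂ : List R) :
    (Ideal.ofList l₁ • ⊤ : Submodule R N) ≤ Ideal.ofList (l₁ ++ l₂) • ⊤ := by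
  rw [ofList_append_smul_top]
  exact le_sup_left

theorem factor_eq_zero_iff {l : List R} {x : R} (hx : x ∈ Set.center R)
    (y : N ⧸ (Ideal.ofList l • ⊤ : Submodule R N)) :
    Submodule.factor (ofList_smul_top_le_append l [x]) y = 0 ↔ ∃ y', x • y' = y := by
  obtain ⟨n, rfl⟩ := Submodule.Quotient.mk_surjective _ y
  rw [← Submodule.mkQ_apply, Submodule.factor_mk, Submodule.mkQ_apply, Submodule.mkQ_apply,
    Submodule.Quotient.mk_eq_zero,
    mem_ofList_append_singleton_smul_top hx]
  constructor
  · rintro ⟨n', h⟩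
    exact ⟨Submodule.Quotient.mk n', ((Submodule.Quotient.eq _).2 h).symm⟩
  · rintro ⟨y', h⟩
    obtain ⟨n', rfl⟩ := Submodule.Quotient.mk_surjective _ y'
    exact ⟨n', (Submodule.Quotient.eq _).1 h.symm⟩

variable (R N) in
theorem bijective_mkQ_ofList_nil :
    Function.Bijective (Submodule.mkQ (Ideal.ofList ([] : List R) • ⊤ : Submodule R N)) := by
  refine ⟨LinearMap.ker_eq_bot.1 ?_, Submodule.mkQ_surjective _⟩
  rw [Submodule.ker_mkQ, Ideal.ofList_nil, Submodule.bot_smul]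

end Central

/-! ### Depth over a local ring -/

section Local

variable {R : Type u} [CommRing R] (I : Ideal R)

/-- Multiplication by the elements of an ideal. -/
def smulOp (N : Type*) [AddCommGroup N] [Module R N] (s : I) : AddMonoid.End N :=
  Module.toAddMonoidEnd R N s

variable {N N' : Type*} [AddCommGroup N] [Module R N] [AddCommGroup N'] [Module R N']

theorem smulOp_apply (s : I) (n : N) : smulOp I N s n = (s : R) • n := rfl

theorem smulOp_comm (s t : I) (n : N) :
    smulOp I N s (smulOp I N t n) = smulOp I N t (smulOp I N s n) := smul_comm (s : R) (t : R) n

theorem map_smulOp (f : N →ₗ[R] N') (s : I) (n : N) :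
    f (smulOp I N s n) = smulOp I N' s (f n) := map_smul f _ _

variable {I}

/-- Starting from the quotient by the whole sequence, where acyclicity below `0` is vacuous, each
element removed from the end gains one degree. -/
theorem opAcyclic_smulOp_of_isRegularOn {xs : List R} (hmem : ∀ x ∈ xs, x ∈ I)
    (hreg : IsRegularOn N xs) : OpAcyclic (smulOp I N) xs.length := by
  have key : ∀ k i, i + k = xs.length →
      OpAcyclic (smulOp I (N ⧸ (Ideal.ofList (xs.take i) • ⊤ : Submodule R N))) k := by
    intro k
    induction k with
    | zero => exact fun i _ j hj => absurd hj (Nat.not_lt_zero j)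
    | succ k ih =>
      intro i hi
      have hil : i < xs.length := by omega
      have h := ih (i + 1) (by omega)
      rw [List.take_succ_eq_append_getElem hil] at h
      let q := Submodule.factor (ofList_smul_top_le_append (R := R) (N := N) (xs.take i) [xs[i]])
      exact OpAcyclic.of_quotient (smulOp_comm I) ⟨xs[i], hmem _ (List.getElem_mem hil)⟩
        (hreg i hil) q.toAddMonoidHom (map_smulOp I q) (Submodule.factor_surjective
          (ofList_smul_top_le_append (N := N) (xs.take i) [xs[i]])) (factor_eq_zero_iff (N := N) (by simp)) h
  exact (OpAcyclic.iff_of_bijective (Submodule.mkQ _).toAddMonoidHom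
    (map_smulOp I (Submodule.mkQ _)) (bijective_mkQ_ofList_nil R N)).2 (key xs.length 0 (zero_add _))

/-- The sequence is built greedily: as long as some acyclicity remains, degree `0` supplies a
regular element of `I`, and the quotient loses exactly one degree. -/
theorem exists_isRegularOn_of_opAcyclic_smulOp [IsNoetherianRing R] [Module.Finite R N] {r : ℕ}
    (h : OpAcyclic (smulOp I N) r) :
    ∃ xs : List R, (∀ x ∈ xs, x ∈ I) ∧ IsRegularOn N xs ∧ xs.length = r := by
  have key : ∀ k ≤ r, ∃ xs : List R, ((∀ x ∈ xs, x ∈ I) ∧ IsRegularOn N xs ∧ xs.length = k) ∧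
      OpAcyclic (smulOp I (N ⧸ (Ideal.ofList xs • ⊤ : Submodule R N))) (r - k) := by
    intro k
    induction k with
    | zero =>
      refine fun _ => ⟨[], ⟨by simp, fun i hi => absurd hi (Nat.not_lt_zero i), rfl⟩, ?_⟩
      exact OpAcyclic.of_bijective (Submodule.mkQ _).toAddMonoidHom 
        (map_smulOp I (Submodule.mkQ _)) (bijective_mkQ_ofList_nil R N) h
    | succ k ih =>
      intro hk
      obtain ⟨xs, ⟨hmem, hreg, hlen⟩, hac⟩ := ih (by omega)
      rw [show r - k = r - (k + 1) + 1 by omega] at hac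
      -- A map from `R / I` is determined by the image of `1`, which is killed by `I`. Vanishing of
      -- all such maps is equivalent to the existence of a regular element in `I`.
      have hsub : Subsingleton ((R ⧸ I) →ₗ[R] (N ⧸ (Ideal.ofList xs • ⊤ : Submodule R N))) := by
        refine subsingleton_of_forall_eq 0 fun f => ?_
        have h1 : f (Submodule.Quotient.mk 1) = 0 := hac.eq_zero fun s => by
          rw [← map_smulOp, smulOp_apply, ← Submodule.Quotient.mk_smul,
            (Submodule.Quotient.mk_eq_zero I).2 (by simp), map_zero]
        refine LinearMap.ext fun y => ?_
        obtain ⟨a, rfl⟩ := Submodule.Quotient.mk_surjective _ y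
        have h2 : (Submodule.Quotient.mk a : R ⧸ I) = a • Submodule.Quotient.mk 1 := by
          rw [← Submodule.Quotient.mk_smul, smul_eq_mul, mul_one]
        rw [h2, map_smul, h1, smul_zero]
        rfl
      obtain ⟨x, hx, hxreg⟩ := IsSMulRegular.subsingleton_linearMap_iff.1 hsub
      rw [Ideal.annihilator_quotient] at hx
      refine ⟨xs ++ [x], ⟨?_, hreg.append_singleton hxreg, by simp [hlen]⟩, ?_⟩
      · simp only [List.mem_append, List.mem_singleton]
        rintro y (hy | rfl)
        exacts [hmem y hy, hx]
      · let q := Submodule.factor (ofList_smul_top_le_append (N := N) xs [x])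
        exact OpAcyclic.quotient (smulOp_comm I) ⟨x, hx⟩ hxreg q.toAddMonoidHom (map_smulOp I q)
          (Submodule.factor_surjective (ofList_smul_top_le_append (N := N) xs [x]))
          (factor_eq_zero_iff (by simp)) hac
  obtain ⟨xs, hxs, -⟩ := key r le_rfl
  exact ⟨xs, hxs⟩

theorem iInf_localDepth_le [IsLocalRing R] [IsNoetherianRing R] {C : Type w'} [Category.{v} C]
    {Φ : C ⥤ ModuleCat.{w} R} (M : Cone Φ) [Module.Finite R M.pt] (hM : AllLVanish M) :
    ⨅ c : C, localDepth R (Φ.obj c) ≤ localDepth R M.pt := by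
  refine ENat.forall_natCast_le_iff_le.1 fun r hr => ?_
  have hΦ : ∀ c, OpAcyclic (smulOp (IsLocalRing.maximalIdeal R) (Φ.obj c)) r := by
    intro c
    obtain ⟨xs, ⟨hmem, hreg⟩, hlen⟩ := exists_le_length_of_le_iSup
      (by simp) (hr.trans (iInf_le _ c))
    exact (opAcyclic_smulOp_of_isRegularOn hmem hreg.regular_mod_prev).mono hlen
  have hX : ∀ n, OpAcyclic (smulOp (IsLocalRing.maximalIdeal R) (Cochain Φ n)) r := fun n =>
    OpAcyclic.pi (fun _ _ _ => rfl) fun σ => hΦ _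
  have hMr : OpAcyclic (smulOp (IsLocalRing.maximalIdeal R) M.pt) r :=
    OpAcyclic.of_exact (fun n => (coboundary Φ n).toAddMonoidHom) (fun n => smulOp_comm _)
      (fun n => map_smulOp _ (coboundary Φ n)) coboundary_coboundary
      (fun n u hu => hM.exists_coboundary_eq hu) (augmentation M).toAddMonoidHom
      (map_smulOp _ (augmentation M)) hM.augmentation_injective (coboundary_augmentation M)
      (fun u hu => hM.exists_augmentation_eq hu) hX
  obtain ⟨xs, hmem, hreg, hlen⟩ :=
    exists_isRegularOn_of_opAcyclic_smulOp hMr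
  rw [← hlen]
  exact le_iSup₂_of_le (f := fun (xs : List R) (_ : (∀ x ∈ xs, x ∈ IsLocalRing.maximalIdeal R) ∧
    RingTheory.Sequence.IsWeaklyRegular M.pt xs) => (xs.length : ℕ∞)) xs ⟨hmem, ⟨hreg⟩⟩ le_rfl

end Local

/-! ### Existence of homogeneous regular elements -/

section Annihilators

variable {R : Type u} [Ring R] {N : Type w} [AddCommGroup N] [Module R N]

/-- An annihilator in the center is recovered from the left ideal it generates in `R`. Hence maximal
annihilators exist because `R` is noetherian, without noetherianity of the center. -/
theorem mem_span_image_torsionOf {q : N} {z : Subring.center R} :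
    (z : R) ∈ Ideal.span ((Subring.center R).subtype ''
      (Ideal.torsionOf (Subring.center R) N q : Set (Subring.center R))) ↔
      z ∈ Ideal.torsionOf (Subring.center R) N q := by
  refine ⟨fun h => ?_, fun h => Ideal.subset_span ⟨z, h, rfl⟩⟩
  have h1 : Ideal.span ((Subring.center R).subtype ''
      (Ideal.torsionOf (Subring.center R) N q : Set (Subring.center R))) ≤
      Ideal.torsionOf R N q := by
    rw [Ideal.span_le]
    rintro _ ⟨y, hy, rfl⟩
    exact hy
  exact h1 h

/-- An element of a module whose annihilator in the center of the ring is maximal among the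
annihilators of nonzero elements. -/
def HasMaximalTorsion (R : Type u) [Ring R] {N : Type w} [AddCommGroup N] [Module R N]
    (q : N) : Prop :=
  q ≠ 0 ∧ ∀ q' : N, q' ≠ 0 →
    Ideal.torsionOf (Subring.center R) N q ≤ Ideal.torsionOf (Subring.center R) N q' →
    Ideal.torsionOf (Subring.center R) N q' = Ideal.torsionOf (Subring.center R) N q

theorem exists_hasMaximalTorsion [IsNoetherianRing R] {q : N} (hq : q ≠ 0) :
    ∃ q' : N, HasMaximalTorsion R q' ∧
      Ideal.torsionOf (Subring.center R) N q ≤ Ideal.torsionOf (Subring.center R) N q' := by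
  let J : N → Ideal R := fun q =>
    Ideal.span ((Subring.center R).subtype ''
      (Ideal.torsionOf (Subring.center R) N q : Set (Subring.center R)))
  have hJ : ∀ {a b : N}, Ideal.torsionOf (Subring.center R) N a ≤
      Ideal.torsionOf (Subring.center R) N b → J a ≤ J b := fun h =>
    Ideal.span_mono (Set.image_mono h)
  obtain ⟨_, ⟨q', ⟨hq', hle⟩, rfl⟩, hmax⟩ := WellFounded.has_min
    (wellFounded_gt (α := Ideal R)) (J '' {a | a ≠ 0 ∧ Ideal.torsionOf (Subring.center R) N q ≤
      Ideal.torsionOf (Subring.center R) N a}) ⟨_, q, ⟨hq, le_rfl⟩, rfl⟩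
  refine ⟨q', ⟨hq', fun a ha hqa => le_antisymm (fun z hz => ?_) hqa⟩, hle⟩
  have h1 : J q' = J a := eq_of_le_of_not_lt (hJ hqa) (hmax _ ⟨a, ⟨ha, hle.trans hqa⟩, rfl⟩)
  rw [← mem_span_image_torsionOf] at hz ⊢
  exact h1.symm.le hz

/-- If `y z` kills `q` but `z` does not, then `z q` is nonzero with an annihilator containing that
of `q`, hence equal to it, and `y` lies in it. -/
theorem HasMaximalTorsion.isPrime {q : N} (hq : HasMaximalTorsion R q) :
    (Ideal.torsionOf (Subring.center R) N q).IsPrime := by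
  refine Ideal.isPrime_iff.2 ⟨fun h => hq.1 ?_, fun {y z} hyz => ?_⟩
  · have h1 : (1 : Subring.center R) ∈ Ideal.torsionOf (Subring.center R) N q := h ▸ trivial
    simpa using h1
  · by_cases hz : z • q = 0
    · exact Or.inr hz
    · left
      rw [← hq.2 (z • q) hz fun a ha => ?_]
      · simpa [Ideal.mem_torsionOf_iff, mul_smul] using hyz
      · rw [Ideal.mem_torsionOf_iff] at ha ⊢
        rw [smul_comm, ha, smul_zero]

/-- Given infinitely many, the spans of the corresponding elements stabilize, so some `q n` lies in
the span of its predecessors and is killed by the intersection of their annihilators. By primality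
one of these lies in that of `q n`, and maximality makes them equal. -/
theorem finite_torsionOf_hasMaximalTorsion [IsNoetherian R N] :
    ((fun q : N => Ideal.torsionOf (Subring.center R) N q) '' {q | HasMaximalTorsion R q}).Finite := by
  by_contra hinf
  let f := Set.Infinite.natEmbedding _ hinf
  choose q hq hfq using fun n => (f n).2
  obtain ⟨n, hn⟩ := monotone_stabilizes_iff_noetherian.2 (inferInstanceAs (IsNoetherian R N))
    ⟨fun n => Submodule.span R (q '' Set.Iio n), fun a b hab =>
      Submodule.span_mono (Set.image_mono (Set.Iio_subset_Iio hab))⟩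
  have h1 : q n ∈ Submodule.span R (q '' Set.Iio n) := by
    have h2 : q n ∈ Submodule.span R (q '' Set.Iio (n + 1)) :=
      Submodule.subset_span ⟨n, Nat.lt_succ_self n, rfl⟩
    have h3 := hn (n + 1) (Nat.le_succ n)
    exact h3.symm.le h2
  have h4 : (Finset.range n).inf (fun i => Ideal.torsionOf (Subring.center R) N (q i)) ≤
      Ideal.torsionOf (Subring.center R) N (q n) := by
    intro z hz
    simp only [Submodule.mem_finsetInf, Finset.mem_range] at hz
    rw [Ideal.mem_torsionOf_iff]
    generalize q n = y at h1
    induction h1 using Submodule.span_induction with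
    | mem y hy =>
      obtain ⟨i, hi, rfl⟩ := hy
      exact hz i hi
    | zero => exact smul_zero _
    | add a b _ _ ha hb => rw [smul_add, ha, hb, add_zero]
    | smul r a _ ha => rw [smul_comm, ha, smul_zero]
  obtain ⟨i, hi, hle⟩ := (hq n).isPrime.inf_le'.1 h4
  have h5 : f n = f i := Subtype.ext <| by
    rw [← hfq, ← hfq]
    exact (hq i).2 _ (hq n).1 hle
  exact (Finset.mem_range.1 hi).ne' (f.injective h5)

end Annihilators

/-! ### Homogeneous prime avoidance -/

section Avoidance

variable {Z : Type*} [CommRing Z] (H : ℕ → AddSubmonoid Z)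
  (hmul : ∀ {d e x y}, x ∈ H d → y ∈ H e → x * y ∈ H (d + e))

include hmul

theorem pow_mem_of_mul_mem {d : ℕ} {x : Z} (hx : x ∈ H d) (k : ℕ) :
    x ^ (k + 1) ∈ H ((k + 1) * d) := by
  induction k with
  | zero => simpa using hx
  | succ k ih =>
    rw [pow_succ, Nat.succ_mul]
    exact hmul ih hx

/-- Homogeneous prime avoidance. -/
theorem exists_homogeneous_notMem (t : Finset (Ideal Z)) (hprime : ∀ p ∈ t, p.IsPrime)
    (hex : ∀ p ∈ t, ∃ e > 0, ∃ x ∈ H e, x ∉ p) : ∃ e > 0, ∃ x ∈ H e, ∀ p ∈ t, x ∉ p := by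
  classical
  induction t using Finset.strongInduction with
  | H t ih =>
  have ih' : ∀ p ∈ t, ∃ e > 0, ∃ x ∈ H e, ∀ p' ∈ t.erase p, x ∉ p' := fun p hp =>
    ih _ (Finset.erase_ssubset hp) (fun p' hp' => hprime p' (Finset.mem_of_mem_erase hp'))
      (fun p' hp' => hex p' (Finset.mem_of_mem_erase hp'))
  rcases t.eq_empty_or_nonempty with rfl | ⟨p, hp⟩
  · exact ⟨1, one_pos, 0, zero_mem _, by simp⟩
  have hpp := hprime p hp
  obtain ⟨a, ha, x, hx, hxt⟩ := ih' p hp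
  by_cases hxp : x ∈ p
  swap
  · refine ⟨a, ha, x, hx, fun p' hp' => ?_⟩
    by_cases h : p' = p
    · rwa [h]
    · exact hxt p' (Finset.mem_erase.2 ⟨h, hp'⟩)
  -- If `p` contains the elements of `p'` that are homogeneous of positive degree, avoiding `p`
  -- already avoids `p'`, so `p'` can be dropped.
  by_cases hsub : ∃ p' ∈ t.erase p, ∀ e > 0, ∀ y ∈ H e, y ∈ p' → y ∈ p
  · obtain ⟨p', hp', hle⟩ := hsub
    obtain ⟨b, hb, y, hy, hyt⟩ := ih' p' (Finset.mem_of_mem_erase hp')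
    refine ⟨b, hb, y, hy, fun p'' hp'' => ?_⟩
    by_cases h : p'' = p'
    · rw [h]
      exact fun hyp => hyt p (Finset.mem_erase.2 ⟨(Finset.ne_of_mem_erase hp').symm, hp⟩)
        (hle b hb y hy hyp)
    · exact hyt p'' (Finset.mem_erase.2 ⟨h, hp''⟩)
  · push Not at hsub
    -- Otherwise a product of homogeneous elements, one in each `p'` but outside `p`, lies in every
    -- other prime and not in `p`. The extra factor from `hex` covers empty `s`.
    have hprod : ∀ s ⊆ t.erase p, ∃ e > 0, ∃ y ∈ H e, y ∉ p ∧ ∀ p' ∈ s, y ∈ p' := by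
      intro s
      induction s using Finset.induction with
      | empty =>
        obtain ⟨e, he, y, hy, hyp⟩ := hex p hp
        exact fun _ => ⟨e, he, y, hy, hyp, by simp⟩
      | insert p' s _ ihs =>
        intro hs
        obtain ⟨e, he, y, hy, hyp, hys⟩ := ihs ((Finset.subset_insert _ _).trans hs)
        obtain ⟨e', he', y', hy', hyp', hyp''⟩ := hsub p' (hs (Finset.mem_insert_self _ _))
        refine ⟨e + e', by omega, y * y', hmul hy hy', fun h => ?_, fun p'' hp'' => ?_⟩
        · exact (hpp.mem_or_mem h).elim hyp hyp''
        · rcases Finset.mem_insert.1 hp'' with rfl | h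
          · exact Ideal.mul_mem_left _ _ hyp'
          · exact Ideal.mul_mem_right _ _ (hys _ h)
    obtain ⟨b, hb, y, hy, hyp, hyt⟩ := hprod _ subset_rfl
    obtain ⟨a, rfl⟩ : ∃ a', a = a' + 1 := ⟨a - 1, by omega⟩
    obtain ⟨b, rfl⟩ : ∃ b', b = b' + 1 := ⟨b - 1, by omega⟩
    -- The exponents equalize the degrees `a + 1` and `b + 1`. Each prime contains exactly one of
    -- the two summands.
    refine ⟨(b + 1) * (a + 1), by positivity, x ^ (b + 1) + y ^ (a + 1),
      add_mem (pow_mem_of_mul_mem H hmul hx b) ?_, fun p' hp' h => ?_⟩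
    · rw [mul_comm (b + 1)]
      exact pow_mem_of_mul_mem H hmul hy a
    · by_cases hpp' : p' = p
      · rw [hpp'] at h
        exact hyp (hpp.mem_of_pow_mem _ ((p.add_mem_iff_right
          (p.pow_mem_of_mem hxp _ b.succ_pos)).1 h))
      · have hp'' := Finset.mem_erase.2 ⟨hpp', hp'⟩
        exact hxt p' hp'' ((hprime p' hp').mem_of_pow_mem _ ((p'.add_mem_iff_left
          (p'.pow_mem_of_mem (hyt p' hp'') _ a.succ_pos)).1 h))

end Avoidance

/-! ### Central homogeneous elements -/

section Graded

variable {F : Type u'} [Field F] {R : Type u} [Ring R] [Algebra F R]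

/-- Central homogeneous elements of positive degree. -/
structure CentralHomogeneous (𝒜 : ℕ → Submodule F R) where
  deg : ℕ
  val : R
  deg_pos : 0 < deg
  val_mem : val ∈ 𝒜 deg
  val_mem_center : val ∈ Set.center R

theorem CentralHomogeneous.mul_comm {𝒜 : ℕ → Submodule F R} (s : CentralHomogeneous 𝒜) (r : R) :
    s.val * r = r * s.val :=
  (Set.mem_center_iff.1 s.val_mem_center).comm r

/-- If no nonzero element of a finitely generated module is annihilated by all central homogeneous
elements of positive degree, then one of these elements is not a zero divisor on the module. -/
theorem exists_isSMulRegular [IsNoetherianRing R] (𝒜 : ℕ → Submodule F R) [GradedAlgebra 𝒜]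
    {N : Type w} [AddCommGroup N] [Module R N] [Module.Finite R N]
    (h : ∀ n : N, (∀ s : CentralHomogeneous 𝒜, s.val • n = 0) → n = 0) :
    ∃ s : CentralHomogeneous 𝒜, IsSMulRegular N s.val := by
  have hfin := finite_torsionOf_hasMaximalTorsion (R := R) (N := N)
  obtain ⟨e, he, x, hx, hxt⟩ := exists_homogeneous_notMem
    (fun e => (𝒜 e).toAddSubmonoid.comap (Subring.center R).subtype)
    (fun hx hy => SetLike.mul_mem_graded (A := 𝒜) hx hy) hfin.toFinset (by
      intro p hp
      obtain ⟨q, hq, rfl⟩ := hfin.mem_toFinset.1 hp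
      exact HasMaximalTorsion.isPrime hq) (by
      intro p hp
      obtain ⟨q, hq, rfl⟩ := hfin.mem_toFinset.1 hp
      by_contra! hcon
      exact hq.1 (h q fun s => hcon s.deg s.deg_pos ⟨s.val, s.val_mem_center⟩ s.val_mem))
  refine ⟨⟨e, x, he, hx, x.2⟩, isSMulRegular_iff_right_eq_zero_of_smul.2 fun q hq => ?_⟩
  -- An element killed by `x` would put `x` into some maximal annihilator, and `x` was chosen
  -- outside all of them.
  by_contra hq0
  obtain ⟨q', hq', hle⟩ := exists_hasMaximalTorsion (R := R) hq0
  exact hxt _ (hfin.mem_toFinset.2 ⟨q', hq', rfl⟩) (hle (show x • q = 0 from hq))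

/-- In a graded algebra that is commutative or graded-commutative, a homogeneous element is central
or has square zero. -/
theorem mem_center_or_mul_self_eq_zero {𝒜 : ℕ → Submodule F R} [GradedAlgebra 𝒜]
    (h : (∀ x y : R, x * y = y * x) ∨ IsGradedCommutative 𝒜) {e : ℕ} {x : R} (hx : x ∈ 𝒜 e) :
    x ∈ Set.center R ∨ x * x = 0 := by
  rcases h with h | h
  · exact Or.inl (Semigroup.mem_center_iff.2 fun y => h y x)
  have key : (∀ j : ℕ, (-1 : R) ^ (e * j) = 1) → x ∈ Set.center R := by
    refine fun h1 => Semigroup.mem_center_iff.2 fun y => ?_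
    induction y using DirectSum.Decomposition.inductionOn 𝒜 with
    | zero => simp
    | homogeneous y => rename_i j; rw [h e j x y hx y.2, h1, one_mul]
    | add a b ha hb => rw [add_mul, mul_add, ha, hb]
  rcases Nat.even_or_odd e with he | he
  · exact Or.inl (key fun j => (he.mul_right j).neg_one_pow)
  by_cases h2 : (2 : F) = 0
  · have h3 : (-1 : R) = 1 := by
      have h4 := congrArg (algebraMap F R) h2
      rw [map_ofNat, map_zero] at h4
      rw [neg_eq_iff_add_eq_zero, one_add_one_eq_two, h4]
    exact Or.inl (key fun j => by rw [h3, one_pow])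
  · right
    have h3 := h e e x x hx hx
    rw [(he.mul he).neg_one_pow, neg_one_mul, eq_neg_iff_add_eq_zero, ← two_smul F] at h3
    exact (smul_eq_zero.1 h3).resolve_left h2

end Graded

/-! ### Degreewise products of graded modules -/

section GradedProduct

variable {F : Type u'} [Field F] {R : Type u} [Ring R] [Algebra F R] {𝒜 : ℕ → Submodule F R}
  {Q Q' : Type*} [AddCommGroup Q] [Module R Q] [AddCommGroup Q'] [Module R Q']
  {G : ℕ → AddSubgroup Q} {G' : ℕ → AddSubgroup Q'}

/-- The product of the homogeneous parts of a module. -/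
abbrev GradedProduct (G : ℕ → AddSubgroup Q) : Type _ := ∀ d, G d

/-- The homogeneous parts `G d` of a module are compatible with the multiplication. -/
def IsGradedAction (𝒜 : ℕ → Submodule F R) (G : ℕ → AddSubgroup Q) : Prop :=
  ∀ ⦃e d : ℕ⦄ ⦃x : R⦄ ⦃q : Q⦄, x ∈ 𝒜 e → q ∈ G d → x • q ∈ G (e + d)

theorem IsGradedAction.smul_sub_mem (hG : IsGradedAction 𝒜 G) {e d : ℕ} {x : R} (hx : x ∈ 𝒜 e)
    (h : e ≤ d) {q : Q} (hq : q ∈ G (d - e)) : x • q ∈ G d := by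
  have := hG hx hq
  rwa [Nat.add_sub_cancel' h] at this

/-- Multiplication by a central homogeneous element on the product of the homogeneous parts. -/
def shiftOp (hG : IsGradedAction 𝒜 G) (s : CentralHomogeneous 𝒜) :
    AddMonoid.End (GradedProduct G) where
  toFun u := fun d =>
    -- There are no negative degrees, so the components below `s.deg` of a multiple of `s` are zero.
    if h : s.deg ≤ d then ⟨s.val • (u (d - s.deg) : Q), hG.smul_sub_mem s.val_mem h (u _).2⟩ else 0
  map_zero' := by
    funext d
    ext
    by_cases h : s.deg ≤ d <;> simp [h]
  map_add' u v := by
    funext d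
    ext
    by_cases h : s.deg ≤ d <;> simp [h]

theorem coe_shiftOp_apply (hG : IsGradedAction 𝒜 G) (s : CentralHomogeneous 𝒜)
    (u : GradedProduct G) (d : ℕ) :
    (shiftOp hG s u d : Q) = if s.deg ≤ d then s.val • (u (d - s.deg) : Q) else 0 := by
  change ((if h : s.deg ≤ d then _ else 0 : G d) : Q) = _
  by_cases h : s.deg ≤ d <;> simp [h]

theorem shiftOp_comm (hG : IsGradedAction 𝒜 G) (s t : CentralHomogeneous 𝒜)
    (u : GradedProduct G) : shiftOp hG s (shiftOp hG t u) = shiftOp hG t (shiftOp hG s u) := by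
  funext d
  ext
  simp only [coe_shiftOp_apply]
  by_cases h : s.deg + t.deg ≤ d
  · rw [if_pos (by omega), if_pos (by omega), if_pos (by omega), if_pos (by omega), smul_smul,
      smul_smul, s.mul_comm, Nat.sub_right_comm]
  · have h1 : s.deg ≤ d → ¬ t.deg ≤ d - s.deg := by omega
    have h2 : t.deg ≤ d → ¬ s.deg ≤ d - t.deg := by omega
    by_cases hs : s.deg ≤ d <;> by_cases ht : t.deg ≤ d <;> simp [hs, ht, h1, h2]

/-- The complex of the central homogeneous elements of positive degree acting on the product of the
homogeneous parts has no cohomology in degrees less than `r`. -/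
abbrev GradedAcyclic (hG : IsGradedAction 𝒜 G) (r : ℕ) : Prop :=
  OpAcyclic (N := GradedProduct G) (shiftOp hG) r

/-- The map of products induced by a linear map that preserves degrees. -/
def gradedProductMap (f : Q →ₗ[R] Q') (hf : ∀ d, ∀ q ∈ G d, f q ∈ G' d) :
    GradedProduct G →+ GradedProduct G' where
  toFun u := fun d => ⟨f (u d), hf d _ (u d).2⟩
  map_zero' := by funext d; ext; simp
  map_add' u v := by funext d; ext; simp

theorem gradedProductMap_shiftOp (hG : IsGradedAction 𝒜 G) (hG' : IsGradedAction 𝒜 G')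
    (f : Q →ₗ[R] Q') (hf : ∀ d, ∀ q ∈ G d, f q ∈ G' d) (s : CentralHomogeneous 𝒜)
    (u : GradedProduct G) :
    gradedProductMap f hf (shiftOp hG s u) = shiftOp hG' s (gradedProductMap f hf u) := by
  funext d
  ext
  change f (shiftOp hG s u d : Q) = _
  rw [coe_shiftOp_apply, coe_shiftOp_apply, apply_ite f, map_smul, map_zero]
  rfl

theorem gradedProductMap_surjective (f : Q →ₗ[R] Q') (hf : ∀ d, ∀ q ∈ G d, f q ∈ G' d)
    (hsurj : ∀ d, ∀ q' ∈ G' d, ∃ q ∈ G d, f q = q') :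
    Function.Surjective (gradedProductMap f hf) := by
  intro u
  choose v hv hvu using fun d => hsurj d (u d) (u d).2
  exact ⟨fun d => ⟨v d, hv d⟩, funext fun d => Subtype.ext (hvu d)⟩

theorem shiftOp_injective (hG : IsGradedAction 𝒜 G) {s : CentralHomogeneous 𝒜}
    (hs : IsSMulRegular Q s.val) : Function.Injective (shiftOp hG s) := by
  intro u v huv
  funext d
  have h := congrArg Subtype.val (congrFun huv (d + s.deg))
  rw [coe_shiftOp_apply, coe_shiftOp_apply, if_pos (by omega), if_pos (by omega),
    Nat.add_sub_cancel] at h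
  exact Subtype.ext (hs h)

end GradedProduct

/-! ### Homogeneous submodules and quotients -/

section Homogeneous

variable {F : Type u'} [Field F] {R : Type u} [Ring R] [Algebra F R] {𝒜 : ℕ → Submodule F R}
  {N : Type w} [AddCommGroup N] [Module R N] [Module F N]
  (ℳ : ℕ → Submodule F N) [DirectSum.Decomposition ℳ]

open DirectSum

theorem coe_decompose_smul_of_mem [SetLike.GradedSMul 𝒜 ℳ] {e : ℕ} {x : R} (hx : x ∈ 𝒜 e) (n : N)
    (d : ℕ) : (decompose ℳ (x • n) d : N) = if e ≤ d then x • (decompose ℳ n (d - e) : N) else 0 := by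
  induction n using Decomposition.inductionOn ℳ with
  | zero => simp
  | homogeneous n =>
    rename_i i
    have h : x • (n : N) ∈ ℳ (e + i) := SetLike.GradedSMul.smul_mem hx n.2
    by_cases hd : e + i = d
    · subst hd
      rw [decompose_of_mem_same ℳ h, if_pos (by omega), Nat.add_sub_cancel_left,
        decompose_of_mem_same ℳ n.2]
    · rw [decompose_of_mem_ne ℳ h hd]
      split_ifs with hed
      · rw [decompose_of_mem_ne ℳ n.2 (by omega), smul_zero]
      · rfl
  | add a b ha hb =>
    rw [smul_add, decompose_add, DirectSum.add_apply, Submodule.coe_add, ha, hb, decompose_add, DirectSum.add_apply,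
      Submodule.coe_add]
    split_ifs
    · rw [smul_add]
    · rw [add_zero]

/-- A submodule that contains the homogeneous components of its elements. -/
def IsHomogeneousSubmodule (P : Submodule R N) : Prop :=
  ∀ p ∈ P, ∀ d, (decompose ℳ p d : N) ∈ P

theorem isHomogeneousSubmodule_ofList_smul_top [SetLike.GradedSMul 𝒜 ℳ] {l : List R}
    (hl : ∀ x ∈ l, x ∈ Set.center R ∧ ∃ e, x ∈ 𝒜 e) :
    IsHomogeneousSubmodule ℳ (Ideal.ofList l • ⊤ : Submodule R N) := by
  induction l with
  | nil =>
    intro p hp d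
    rw [Ideal.ofList_nil, Submodule.bot_smul, Submodule.mem_bot] at hp ⊢
    rw [hp, decompose_zero]
    rfl
  | cons x l ih =>
    have ih' := ih fun y hy => hl y (List.mem_cons_of_mem _ hy)
    obtain ⟨hx, e, he⟩ := hl x List.mem_cons_self
    intro p hp d
    rw [← List.singleton_append, ofList_append_smul_top, Submodule.mem_sup] at hp ⊢
    obtain ⟨y, hy, z, hz, rfl⟩ := hp
    obtain ⟨n, rfl⟩ := (mem_ofList_singleton_smul_top hx).1 hy
    refine ⟨decompose ℳ (x • n) d, (mem_ofList_singleton_smul_top hx).2 ?_, decompose ℳ z d,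
      ih' z hz d, by rw [decompose_add, DirectSum.add_apply, Submodule.coe_add]⟩
    rw [coe_decompose_smul_of_mem ℳ he]
    split_ifs
    · exact ⟨_, rfl⟩
    · exact ⟨0, smul_zero _⟩

/-- The homogeneous parts of the quotient by a submodule. -/
def quotientGrading (P : Submodule R N) (d : ℕ) : AddSubgroup (N ⧸ P) :=
  (ℳ d).toAddSubgroup.map P.mkQ.toAddMonoidHom

variable {ℳ}

omit [Algebra F R] [Decomposition ℳ] in
theorem mem_quotientGrading {P : Submodule R N} {d : ℕ} {q : N ⧸ P} :
    q ∈ quotientGrading ℳ P d ↔ ∃ n ∈ ℳ d, P.mkQ n = q := Iff.rfl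

omit [Decomposition ℳ] in
theorem isGradedAction_grading [SetLike.GradedSMul 𝒜 ℳ] :
    IsGradedAction 𝒜 (fun d => (ℳ d).toAddSubgroup) :=
  fun _ _ _ _ hx hq => SetLike.GradedSMul.smul_mem (A := 𝒜) (B := ℳ) hx hq

omit [Decomposition ℳ] in
theorem isGradedAction_quotientGrading [SetLike.GradedSMul 𝒜 ℳ] (P : Submodule R N) :
    IsGradedAction 𝒜 (quotientGrading ℳ P) := by
  intro e d x q hx hq
  obtain ⟨n, hn, rfl⟩ := mem_quotientGrading.1 hq
  exact ⟨x • n, SetLike.GradedSMul.smul_mem hx hn, P.mkQ.map_smul _ _⟩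

section Factor

variable {P P' : Submodule R N} (hPP : P ≤ P')

omit [Algebra F R] [Decomposition ℳ] in
theorem factor_mem_quotientGrading (d : ℕ) (q : N ⧸ P) (hq : q ∈ quotientGrading ℳ P d) :
    Submodule.factor hPP q ∈ quotientGrading ℳ P' d := by
  obtain ⟨n, hn, rfl⟩ := mem_quotientGrading.1 hq
  exact ⟨n, hn, rfl⟩

omit [Algebra F R] [Decomposition ℳ] in
theorem gradedProductMap_factor_surjective :
    Function.Surjective
      (gradedProductMap (Submodule.factor hPP) (factor_mem_quotientGrading (ℳ := ℳ) hPP)) :=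
  gradedProductMap_surjective _ _ fun d q' hq' => by
    obtain ⟨n, hn, rfl⟩ := mem_quotientGrading.1 hq'
    exact ⟨P.mkQ n, ⟨n, hn, rfl⟩, rfl⟩

end Factor

/-- This is the kernel condition needed to divide by `s`. Division is possible in the ungraded
quotient; homogeneity of the submodule allows the quotient element to be replaced by its component
in the right degree. -/
theorem gradedProductMap_factor_eq_zero_iff [SetLike.GradedSMul 𝒜 ℳ] {l : List R}
    (hl : IsHomogeneousSubmodule ℳ (Ideal.ofList l • ⊤ : Submodule R N))
    (s : CentralHomogeneous 𝒜)
    (u : GradedProduct (quotientGrading ℳ (Ideal.ofList l • ⊤ : Submodule R N))) :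
    gradedProductMap (Submodule.factor (ofList_smul_top_le_append l [s.val]))
        (factor_mem_quotientGrading (ℳ := ℳ) _) u = 0 ↔
      ∃ u', shiftOp (isGradedAction_quotientGrading _) s u' = u := by
  constructor
  · intro hu
    have key : ∀ d, ∃ y ∈ quotientGrading ℳ (Ideal.ofList l • ⊤ : Submodule R N) d,
        (u (d + s.deg) : N ⧸ (Ideal.ofList l • ⊤ : Submodule R N)) = s.val • y := by
      intro d
      obtain ⟨n, hn, hnu⟩ := mem_quotientGrading.1 (u (d + s.deg)).2
      have h1 : Submodule.factor (ofList_smul_top_le_append l [s.val]) (u (d + s.deg)).1 = 0 :=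
        congrArg Subtype.val (congrFun hu (d + s.deg))
      obtain ⟨y', hy'⟩ := (factor_eq_zero_iff s.val_mem_center _).1 h1
      obtain ⟨n', rfl⟩ := Submodule.mkQ_surjective _ y'
      refine ⟨_, ⟨decompose ℳ n' d, SetLike.coe_mem _, rfl⟩, ?_⟩
      rw [← hnu, ← map_smul] at hy'
      have h2 := hl _ ((Submodule.Quotient.eq _).1 hy') (d + s.deg)
      rw [decompose_sub, DirectSum.sub_apply, Submodule.coe_sub, coe_decompose_smul_of_mem ℳ s.val_mem,
        if_pos (by omega), Nat.add_sub_cancel, decompose_of_mem_same ℳ hn] at h2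
      exact hnu.symm.trans ((Submodule.Quotient.eq _).2 h2).symm
    -- Below the degree of `s`, a multiple of `s` has no component, so divisibility forces zero.
    have key' : ∀ d < s.deg, (u d : N ⧸ (Ideal.ofList l • ⊤ : Submodule R N)) = 0 := by
      intro d hd
      obtain ⟨n, hn, hnu⟩ := mem_quotientGrading.1 (u d).2
      have h1 : Submodule.factor (ofList_smul_top_le_append l [s.val]) (u d).1 = 0 :=
        congrArg Subtype.val (congrFun hu d)
      obtain ⟨y', hy'⟩ := (factor_eq_zero_iff s.val_mem_center _).1 h1
      obtain ⟨n', rfl⟩ := Submodule.mkQ_surjective _ y'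
      rw [← hnu, ← map_smul] at hy'
      have h2 := hl _ ((Submodule.Quotient.eq _).1 hy'.symm) d
      rw [decompose_sub, DirectSum.sub_apply, Submodule.coe_sub, coe_decompose_smul_of_mem ℳ s.val_mem,
        if_neg (by omega), sub_zero, decompose_of_mem_same ℳ hn] at h2
      exact hnu.symm.trans ((Submodule.Quotient.mk_eq_zero _).2 h2)
    choose y hy hyu using key
    refine ⟨fun d => ⟨y d, hy d⟩, funext fun d => Subtype.ext ?_⟩
    rw [coe_shiftOp_apply]
    split_ifs with h
    · rw [← hyu, Nat.sub_add_cancel h]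
    · exact (key' d (by omega)).symm
  · rintro ⟨u', rfl⟩
    rw [gradedProductMap_shiftOp _ (isGradedAction_quotientGrading _)]
    funext d
    ext
    rw [coe_shiftOp_apply]
    split_ifs with h
    · change s.val • Submodule.factor _ (u' (d - s.deg)).1 = 0
      rw [← map_smul, factor_eq_zero_iff s.val_mem_center]
      exact ⟨_, rfl⟩
    · rfl

variable (𝒜 ℳ) in
omit [Decomposition ℳ] in
theorem opAcyclic_quotientGrading_nil_iff [SetLike.GradedSMul 𝒜 ℳ] {r : ℕ} :
    GradedAcyclic (𝒜 := 𝒜) (isGradedAction_grading (ℳ := ℳ)) r ↔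
      GradedAcyclic (𝒜 := 𝒜) (isGradedAction_quotientGrading (ℳ := ℳ)
        (Ideal.ofList ([] : List R) • ⊤ : Submodule R N)) r := by
  have hb := bijective_mkQ_ofList_nil R N
  have hf : ∀ d, ∀ n ∈ (ℳ d).toAddSubgroup, Submodule.mkQ _ n ∈ quotientGrading ℳ
    (Ideal.ofList ([] : List R) • ⊤ : Submodule R N) d := fun d n hn => ⟨n, hn, rfl⟩
  refine OpAcyclic.iff_of_bijective (gradedProductMap (Submodule.mkQ _) hf)
    (gradedProductMap_shiftOp _ _ _ hf) ⟨fun u v huv => ?_, ?_⟩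
  · exact funext fun d => Subtype.ext (hb.1 (congrArg Subtype.val (congrFun huv d)))
  · exact gradedProductMap_surjective _ _ fun d q' hq' => mem_quotientGrading.1 hq'

/-- The induction of the local case runs as long as the elements are central. A noncentral one ends
it, since the quotient on which it is regular is already zero. -/
theorem opAcyclic_shiftOp_of_isRegularOn [GradedAlgebra 𝒜] [SetLike.GradedSMul 𝒜 ℳ]
    (h𝒜 : (∀ x y : R, x * y = y * x) ∨ IsGradedCommutative 𝒜) {xs : List R}
    (hmem : ∀ x ∈ xs, ∃ d, 0 < d ∧ x ∈ 𝒜 d) (hreg : IsRegularOn N xs) :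
    GradedAcyclic (𝒜 := 𝒜) (isGradedAction_grading (ℳ := ℳ)) xs.length := by
  have key : ∀ k i, i + k = xs.length → (∀ x ∈ xs.take i, x ∈ Set.center R) →
      GradedAcyclic (𝒜 := 𝒜) (isGradedAction_quotientGrading (ℳ := ℳ)
        (Ideal.ofList (xs.take i) • ⊤ : Submodule R N)) k := by
    intro k
    induction k with
    | zero => exact fun i _ _ j hj => absurd hj (Nat.not_lt_zero j)
    | succ k ih =>
      intro i hi hc
      have hil : i < xs.length := by omega
      obtain ⟨d, hd, hxd⟩ := hmem _ (List.getElem_mem hil)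
      rcases mem_center_or_mul_self_eq_zero h𝒜 hxd with hx | hx
      · have h := ih (i + 1) (by omega) (by
          rw [List.take_succ_eq_append_getElem hil]
          simp only [List.mem_append, List.mem_singleton]
          rintro y (hy | rfl)
          exacts [hc y hy, hx])
        rw [List.take_succ_eq_append_getElem hil] at h
        let s : CentralHomogeneous 𝒜 := ⟨d, xs[i], hd, hxd, hx⟩
        exact OpAcyclic.of_quotient (shiftOp_comm _) s (shiftOp_injective _ (hreg i hil))
          (gradedProductMap (Submodule.factor (ofList_smul_top_le_append (xs.take i) [s.val]))
            (factor_mem_quotientGrading (ℳ := ℳ) _))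
          (gradedProductMap_shiftOp _ _ _ _) (gradedProductMap_factor_surjective _)
          (gradedProductMap_factor_eq_zero_iff (isHomogeneousSubmodule_ofList_smul_top ℳ
            fun x hx => ⟨hc x hx, (hmem x (List.mem_of_mem_take hx)).imp fun _ h => h.2⟩) s) h
      -- Multiplication by `x` is injective while its square is zero.
      · have hsub : Subsingleton (N ⧸ (Ideal.ofList (xs.take i) • ⊤ : Submodule R N)) := by
          refine subsingleton_of_forall_eq 0 fun q => hreg i hil (hreg i hil ?_)
          simp only [smul_smul, hx, zero_smul]
        exact opAcyclic_of_subsingleton _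
  exact (opAcyclic_quotientGrading_nil_iff 𝒜 ℳ).2 (key xs.length 0 (zero_add _) (by simp))

/-- Since `P` is homogeneous, the family of components of `q` is killed by every operator too. It
vanishes by acyclicity in degree `0`, and `q` is the sum of its components. -/
theorem GradedAcyclic.eq_zero_of_smul_eq_zero [SetLike.GradedSMul 𝒜 ℳ] {P : Submodule R N}
    (hP : IsHomogeneousSubmodule ℳ P) {r : ℕ}
    (h : GradedAcyclic (𝒜 := 𝒜) (isGradedAction_quotientGrading (ℳ := ℳ) P) (r + 1))
    (q : N ⧸ P) (hq : ∀ s : CentralHomogeneous 𝒜, s.val • q = 0) : q = 0 := by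
  classical
  obtain ⟨n, rfl⟩ := P.mkQ_surjective q
  have h1 : (fun d => ⟨P.mkQ (decompose ℳ n d), ⟨_, SetLike.coe_mem _, rfl⟩⟩ :
      GradedProduct (quotientGrading ℳ P)) = 0 := by
    refine h.eq_zero fun s => funext fun d => Subtype.ext ?_
    rw [coe_shiftOp_apply]
    have h2 := hP _ ((Submodule.Quotient.mk_eq_zero P).1 ((P.mkQ.map_smul _ n).trans (hq s))) d
    rw [coe_decompose_smul_of_mem ℳ s.val_mem] at h2
    split_ifs with hd
    · rw [if_pos hd] at h2
      exact (P.mkQ.map_smul _ _).symm.trans ((Submodule.Quotient.mk_eq_zero P).2 h2)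
    · rfl
  have h3 : ∀ d, P.mkQ (decompose ℳ n d) = 0 := fun d => congrArg Subtype.val (congrFun h1 d)
  rw [← sum_support_decompose ℳ n, map_sum]
  exact Finset.sum_eq_zero fun d _ => h3 d

/-- The greedy construction is kept inside the center: this makes the submodules homogeneous and
identifies the kernels of the quotient maps. -/
theorem exists_isRegularOn_of_opAcyclic_shiftOp [IsNoetherianRing R] [Module.Finite R N]
    [GradedAlgebra 𝒜] [SetLike.GradedSMul 𝒜 ℳ] {r : ℕ}
    (h : GradedAcyclic (𝒜 := 𝒜) (isGradedAction_grading (ℳ := ℳ)) r) :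
    ∃ xs : List R, (∀ x ∈ xs, ∃ d, 0 < d ∧ x ∈ 𝒜 d) ∧ IsRegularOn N xs ∧ xs.length = r := by
  have key : ∀ k ≤ r, ∃ xs : List R, ((∀ x ∈ xs, x ∈ Set.center R ∧ ∃ d, 0 < d ∧ x ∈ 𝒜 d) ∧
      IsRegularOn N xs ∧ xs.length = k) ∧
      GradedAcyclic (𝒜 := 𝒜) (isGradedAction_quotientGrading (ℳ := ℳ)
        (Ideal.ofList xs • ⊤ : Submodule R N)) (r - k) := by
    intro k
    induction k with
    | zero =>
      exact fun _ => ⟨[], ⟨by simp, fun i hi => absurd hi (Nat.not_lt_zero i), rfl⟩,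
        (opAcyclic_quotientGrading_nil_iff 𝒜 ℳ).1 h⟩
    | succ k ih =>
      intro hk
      obtain ⟨xs, ⟨hmem, hreg, hlen⟩, hac⟩ := ih (by omega)
      rw [show r - k = r - (k + 1) + 1 by omega] at hac
      have hhom : IsHomogeneousSubmodule ℳ (Ideal.ofList xs • ⊤ : Submodule R N) :=
        isHomogeneousSubmodule_ofList_smul_top (𝒜 := 𝒜) ℳ fun x hx =>
          ⟨(hmem x hx).1, (hmem x hx).2.imp fun _ h => h.2⟩
      obtain ⟨s, hs⟩ := exists_isSMulRegular 𝒜 (GradedAcyclic.eq_zero_of_smul_eq_zero hhom hac)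
      refine ⟨xs ++ [s.val], ⟨?_, hreg.append_singleton hs, by simp [hlen]⟩, ?_⟩
      · simp only [List.mem_append, List.mem_singleton]
        rintro y (hy | rfl)
        exacts [hmem y hy, ⟨s.val_mem_center, s.deg, s.deg_pos, s.val_mem⟩]
      · exact OpAcyclic.quotient (shiftOp_comm _) s (shiftOp_injective _ hs)
          (gradedProductMap (Submodule.factor (ofList_smul_top_le_append xs [s.val]))
            (factor_mem_quotientGrading (ℳ := ℳ) _))
          (gradedProductMap_shiftOp _ _ _ _) (gradedProductMap_factor_surjective _)
          (gradedProductMap_factor_eq_zero_iff hhom s) hac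
  obtain ⟨xs, ⟨hmem, hreg, hlen⟩, -⟩ := key r le_rfl
  exact ⟨xs, fun x hx => (hmem x hx).2, hreg, hlen⟩

end Homogeneous

/-! ### Depth over a connected graded algebra -/

section GradedLimit

variable {F : Type u'} [Field F] {R : Type u} [Ring R] [Algebra F R]
  {𝒜 : ℕ → Submodule F R} [GradedAlgebra 𝒜]
  {C : Type w'} [Category.{v} C] (Φ : C ⥤ GradedFGMod.{u, u', w} 𝒜)

/-- The product of the homogeneous parts of a graded module. -/
abbrev GradedFGMod.Product (N : GradedFGMod.{u, u', w} 𝒜) : Type w :=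
  GradedProduct fun d => (N.grading d).toAddSubgroup

/-- The action of the central homogeneous elements on the product of the homogeneous parts. -/
abbrev GradedFGMod.op (N : GradedFGMod.{u, u', w} 𝒜) (s : CentralHomogeneous 𝒜) :
    AddMonoid.End N.Product :=
  shiftOp (isGradedAction_grading (ℳ := N.grading)) s

/-- The product of the groups of cochains of all degrees of the homogeneous parts. -/
abbrev GradedCochain (n : ℕ) : Type _ :=
  ∀ σ : ComposableArrows C n, (Φ.obj (σ.obj (Fin.last n))).Product

/-- The homogeneous part of degree `d` of a cochain. -/
def GradedCochain.part {Φ : C ⥤ GradedFGMod.{u, u', w} 𝒜} {n : ℕ} (d : ℕ) (u : GradedCochain Φ n) :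
    Cochain (Φ ⋙ GradedFGMod.degreePart 𝒜 d) n :=
  fun σ => u σ d

/-- The cochain with given homogeneous parts. -/
def GradedCochain.ofParts {Φ : C ⥤ GradedFGMod.{u, u', w} 𝒜} {n : ℕ}
    (u : ∀ d, Cochain (Φ ⋙ GradedFGMod.degreePart 𝒜 d) n) : GradedCochain Φ n :=
  fun σ d => u d σ

/-- The differential of the cochain complexes of all homogeneous parts. -/
def gradedCoboundary (n : ℕ) : GradedCochain Φ n →+ GradedCochain Φ (n + 1) where
  toFun u := GradedCochain.ofParts fun d =>
    coboundary (Φ ⋙ GradedFGMod.degreePart 𝒜 d) n (u.part d)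
  map_zero' := by
    funext σ d
    exact congrFun (map_zero (coboundary (Φ ⋙ GradedFGMod.degreePart 𝒜 d) n)) σ
  map_add' u v := by
    funext σ d
    exact congrFun (map_add (coboundary (Φ ⋙ GradedFGMod.degreePart 𝒜 d) n) _ _) σ

/-- The operators on cochains. -/
def gradedCochainOp (n : ℕ) (s : CentralHomogeneous 𝒜) : AddMonoid.End (GradedCochain Φ n) where
  toFun u := fun σ => (Φ.obj (σ.obj (Fin.last n))).op s (u σ)
  map_zero' := funext fun _ => map_zero _
  map_add' _ _ := funext fun _ => map_add _ _ _

theorem gradedCoboundary_apply (n : ℕ) (u : GradedCochain Φ n) (σ : ComposableArrows C (n + 1))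
    (d : ℕ) : (gradedCoboundary Φ n u σ d : (Φ.obj (σ.obj (Fin.last (n + 1)))).carrier) =
      ∑ k : Fin (n + 2), (-1 : ℤ) ^ (k : ℕ) •
        (Φ.map (faceToLast k σ)).toLinearMap (u (face k σ) d) := by
  refine (congrArg Subtype.val
    (coboundary_apply (Φ := Φ ⋙ GradedFGMod.degreePart 𝒜 d) n (u.part d) σ)).trans ?_
  refine (map_sum ((Φ.obj (σ.obj (Fin.last (n + 1)))).grading d).subtype _ _).trans ?_
  refine Finset.sum_congr rfl fun k _ => ?_
  exact map_zsmul ((Φ.obj (σ.obj (Fin.last (n + 1)))).grading d).subtype _ _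

/-- The operator relates different degrees, but in every degree the differential comes from the same
`R`-linear maps `Φ(f)`, which commute with `s.val`. -/
theorem gradedCoboundary_op (n : ℕ) (s : CentralHomogeneous 𝒜) (u : GradedCochain Φ n) :
    gradedCoboundary Φ n (gradedCochainOp Φ n s u) =
      gradedCochainOp Φ (n + 1) s (gradedCoboundary Φ n u) := by
  funext σ d
  ext
  have h : (gradedCochainOp Φ (n + 1) s (gradedCoboundary Φ n u) σ d :
      (Φ.obj (σ.obj (Fin.last (n + 1)))).carrier) =
      if s.deg ≤ d then s.val • (gradedCoboundary Φ n u σ (d - s.deg) :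
        (Φ.obj (σ.obj (Fin.last (n + 1)))).carrier) else 0 :=
    coe_shiftOp_apply (isGradedAction_grading (ℳ := (Φ.obj (σ.obj (Fin.last (n + 1)))).grading)) s
      (gradedCoboundary Φ n u σ) d
  have h' : ∀ k, (gradedCochainOp Φ n s u (face k σ) d :
      (Φ.obj ((face k σ).obj (Fin.last n))).carrier) =
      if s.deg ≤ d then s.val • (u (face k σ) (d - s.deg) :
        (Φ.obj ((face k σ).obj (Fin.last n))).carrier) else 0 := fun k =>
    coe_shiftOp_apply (isGradedAction_grading (ℳ := (Φ.obj ((face k σ).obj (Fin.last n))).grading))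
      s (u (face k σ)) d
  rw [h, gradedCoboundary_apply, gradedCoboundary_apply]
  simp only [h']
  split_ifs
  · simp only [map_smul, Finset.smul_sum, smul_comm s.val]
  · refine Finset.sum_eq_zero fun k _ => ?_
    rw [map_zero ((Φ.map (faceToLast k σ)).toLinearMap), smul_zero]

variable {Φ}

/-- The augmentation of the cochain complexes of all homogeneous parts. -/
def gradedAugmentation (M : Cone Φ) : M.pt.Product →+ GradedCochain Φ 0 where
  toFun m := fun σ =>
    gradedProductMap (M.π.app (σ.obj (Fin.last 0))).toLinearMap
      (M.π.app (σ.obj (Fin.last 0))).map_mem m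
  map_zero' := funext fun _ => map_zero _
  map_add' _ _ := funext fun _ => map_add _ _ _

theorem GradedCochain.ext_part {n : ℕ} {u v : GradedCochain Φ n} (h : ∀ d, u.part d = v.part d) :
    u = v :=
  funext fun σ => funext fun d => congrFun (h d) σ

theorem iInf_gradedDepth_le [IsNoetherianRing R]
    (h𝒜 : (∀ x y : R, x * y = y * x) ∨ IsGradedCommutative 𝒜) (M : Cone Φ)
    (hM : GradedAllLVanish M) :
    ⨅ c : C, gradedDepth 𝒜 (Φ.obj c).carrier ≤ gradedDepth 𝒜 M.pt.carrier := by
  refine ENat.forall_natCast_le_iff_le.1 fun r hr => ?_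
  have hΦ : ∀ c, OpAcyclic (N := (Φ.obj c).Product) (Φ.obj c).op r := by
    intro c
    obtain ⟨xs, ⟨hmem, hreg⟩, hlen⟩ := exists_le_length_of_le_iSup
      ⟨by simp, fun i hi => absurd hi (Nat.not_lt_zero i)⟩ (hr.trans (iInf_le _ c))
    exact (opAcyclic_shiftOp_of_isRegularOn h𝒜 hmem hreg).mono hlen
  have hX : ∀ n, OpAcyclic (N := GradedCochain Φ n) (gradedCochainOp Φ n) r := fun n =>
    OpAcyclic.pi (fun _ _ _ => rfl) fun σ => hΦ _
  have hMr : OpAcyclic (N := M.pt.Product) M.pt.op r := by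
    refine OpAcyclic.of_exact (X := GradedCochain Φ) (opX := gradedCochainOp Φ) (gradedCoboundary Φ)
      (fun n s t u => funext fun σ => shiftOp_comm isGradedAction_grading _ _ _) (gradedCoboundary_op Φ)
      (fun n u => GradedCochain.ext_part fun d => coboundary_coboundary n (u.part d)) ?_
      (gradedAugmentation M) (fun s m => funext fun σ =>
        gradedProductMap_shiftOp isGradedAction_grading isGradedAction_grading _
          (M.π.app (σ.obj (Fin.last 0))).map_mem _ _) ?_
      (fun m => GradedCochain.ext_part fun d => coboundary_augmentation
        ((GradedFGMod.degreePart 𝒜 d).mapCone M) (m d)) ?_ hX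
    · intro n u hu
      -- Exactness holds in each degree separately; the degreewise primitives form one cochain
      -- because the product over degrees imposes no finiteness condition.
      choose v hv using fun d => (hM d).exists_coboundary_eq (u := u.part d)
        (congrArg (GradedCochain.part d) hu)
      exact ⟨GradedCochain.ofParts v, GradedCochain.ext_part hv⟩
    · exact fun m m' h => funext fun d => (hM d).augmentation_injective
        (congrArg (GradedCochain.part d) h)
    · intro u hu
      choose m hm using fun d => (hM d).exists_augmentation_eq (u := u.part d)
        (congrArg (GradedCochain.part d) hu)
      exact ⟨m, GradedCochain.ext_part hm⟩
  obtain ⟨xs, hmem, hreg, hlen⟩ := exists_isRegularOn_of_opAcyclic_shiftOp hMr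
  rw [← hlen]
  exact le_iSup₂_of_le (f := fun (xs : List R) (_ : (∀ x ∈ xs, ∃ d, 0 < d ∧ x ∈ 𝒜 d) ∧
    IsRegularOn M.pt.carrier xs) => (xs.length : ℕ∞)) xs ⟨hmem, hreg⟩ le_rfl

end GradedLimit

end HigherLimits

theorem corollary1p2 :
    (∀ (R : Type u) [CommRing R] [IsLocalRing R] [IsNoetherianRing R]
      (C : Type w') [Category.{v} C] (Φ : C ⥤ ModuleCat.{w} R)
      [∀ c : C, Module.Finite R (Φ.obj c)]
      (M : Cone Φ) [Module.Finite R M.pt],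
      HigherLimits.AllLVanish M →
        ⨅ c : C, HigherLimits.localDepth R (Φ.obj c) ≤ HigherLimits.localDepth R M.pt) ∧
    (∀ (F : Type u') [Field F] (R : Type u) [Ring R] [Algebra F R] [IsNoetherianRing R]
      (𝒜 : ℕ → Submodule F R) [GradedAlgebra 𝒜],
      HigherLimits.IsConnectedGrading 𝒜 →
      ((∀ x y : R, x * y = y * x) ∨ HigherLimits.IsGradedCommutative 𝒜) →
      ∀ (C : Type w') [Category.{v} C] (Φ : C ⥤ HigherLimits.GradedFGMod.{u, u', w} 𝒜)
        (M : Cone Φ),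
        HigherLimits.GradedAllLVanish M →
          ⨅ c : C, HigherLimits.gradedDepth 𝒜 (Φ.obj c).carrier ≤
            HigherLimits.gradedDepth 𝒜 M.pt.carrier) := by
  exact ⟨fun R _ _ _ C _ Φ _ M _ hM => HigherLimits.iInf_localDepth_le M hM,
    fun F _ R _ _ _ 𝒜 _ _ h𝒜 C _ Φ M hM => HigherLimits.iInf_gradedDepth_le h𝒜 M hM⟩
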